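/- **Theorem.** Let $K$ be an algebraically closed field (for instance $K=\mathbb C$), let $r,k\ge 0$ and $\alpha=(\alpha_1,\dots,\alpha_r)$ with $1\le\alpha_t\le k$ for all $t$. Let $Gr(\alpha,k)=Gr(\alpha_1,k)\times\cdots\times Gr(\alpha_r,k)$ be the variety of tuples $(W_1,\dots,W_r)$ of subspaces of $K^k$ with $\dim W_t=\alpha_t$; it is the quotient of the variety $\mathcal V_\alpha$ of block matrices $A=(A_1\mid\cdots\mid A_r)$, with $A_t$ of size $k\times\alpha_t$ and rank $\alpha_t$, by the column action of $GL_{\alpha_1}\times\cdots\times GL_{\alpha_r}$, where $A$ represents the tuple of column spaces of its blocks. Let $X_{\alpha,k}\subseteq Gr(\alpha,k)$ be the set of those tuples with $W_1+\cdots+W_r=K^k$. A *set sequence of type $\alpha$ in $[k]$* is a tuple $\mathcal I=(I_1,\dots,I_r)$ of nonempty subsets of $[k]=\{1,\dots,k\}$ with $|I_t|=\alpha_t$; it *covers* $[k]$ if $I_1\cup\cdots\cup I_r=[k]$. Put $P_t=I_1\cup\cdots\cup I_{t-1}$, and let $\pi^{(t)}$ be the total order on $[k]$ that lists the elements of $[k]-P_t$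 in increasing order and then those of $P_t$ in increasing order. Let $U(\mathcal I)$ be the set of lower triangular $k\times k$ matrices $u$ over $K$ with ones on the diagonal such that, for $j<i$, $u_{i,j}=0$ unless there is a $t$ with $j\in I_t-P_t$ and $i\notin P_t\cup I_t$. A matrix $B=(B_1\mid\cdots\mid B_r)$, with $B_t$ of size $k\times\alpha_t$, *fits the pattern* of $\mathcal I$ if for every $t$ the columns of $B_t$ are indexed, from left to right, by the elements $i$ of $I_t$ in the order $\pi^{(t)}$, and the column indexed by $i$ has entry $1$ in row $i$, and entry $0$ in each row $j\neq i$ such that $j\in I_t$, or $j$ comes before $i$ in $\pi^{(t)}$, or $i\in I_t-P_t$, $j\notin P_t\cup I_t$ and $j>i$ (its other entries are arbitrary). Let $C_{\mathcal I}\subseteq Gr(\alpha,k)$ be the image of $\{uB : u\in U(\mathcal I),\ B \text{ fits the pattern of } \mathcal I\}$. Then the cells $C_{\mathcal I}$, for $\mathcal I$ ranging over the set sequences of type $\alpha$ in $[k]$, induce an affine paving of $Gr(\alpha,k)$: they are pairwise disjoint, each is isomorphic to an affine space, and there is a chain $\varnothing=X_0\subset X_1\subset\cdots\subset X_m=Gr(\alpha,k)$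 of Zariski closed subsets such that each difference $X_i-X_{i-1}$ is, as a variety, the disjoint union of some of the cells (each relatively open in the difference), every cell occurring in exactly one difference. The chain can be chosen so that in addition $X_{\alpha,k}=Gr(\alpha,k)-X_i$ for some $i$. Moreover $C_{\mathcal I}\subseteq X_{\alpha,k}$ if and only if $\mathcal I$ covers $[k]$, and $C_{\mathcal I}\cap X_{\alpha,k}=\varnothing$ if $\mathcal I$ does not cover $[k]$. -/

import Mathlib

open Topology

/-- A space with functions over a field `K` (a classical, possibly reducible, prevariety is a
special case): a topological space with a sheaf of `K`-algebras of `K`-valued functions for which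
nonvanishing loci are open and reciprocals of nonvanishing regular functions are regular.
`IsRegular U f` says that the restriction of `f` to `U` is regular; only open `U` are meant, and
the values of `f` outside of `U` do not matter. -/
structure SpaceWithFunctions (K : Type*) [Field K] (X : Type*) where
  zariski : TopologicalSpace X
  IsRegular : Set X → (X → K) → Prop
  congr : ∀ {U : Set X} {f g : X → K}, Set.EqOn f g U → IsRegular U f → IsRegular U g
  mono : ∀ {U V : Set X} {f : X → K}, V ⊆ U → IsRegular U f → IsRegular V f
  glue : ∀ {U : Set X} {f : X → K},
    (∀ x ∈ U, ∃ V, IsOpen[zariski] V ∧ x ∈ V ∧ IsRegular (U ∩ V) f) → IsRegular U f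
  const : ∀ (U : Set X) (c : K), IsRegular U (fun _ => c)
  add : ∀ {U : Set X} {f g : X → K},
    IsRegular U f → IsRegular U g → IsRegular U (fun x => f x + g x)
  mul : ∀ {U : Set X} {f g : X → K},
    IsRegular U f → IsRegular U g → IsRegular U (fun x => f x * g x)
  isOpen_ne_zero : ∀ {U : Set X} {f : X → K},
    IsOpen[zariski] U → IsRegular U f → IsOpen[zariski] {x | x ∈ U ∧ f x ≠ 0}
  inv : ∀ {U : Set X} {f : X → K},
    IsRegular U f → IsRegular {x | x ∈ U ∧ f x ≠ 0} (fun x => (f x)⁻¹)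

namespace SpaceWithFunctions

variable {K : Type*} [Field K] {X Y : Type*}

/-- Morphisms are continuous maps that pull regular functions back to regular functions. -/
def IsMorphism (P : SpaceWithFunctions K X) (Q : SpaceWithFunctions K Y) (φ : X → Y) : Prop :=
  (∀ V : Set Y, IsOpen[Q.zariski] V → IsOpen[P.zariski] (φ ⁻¹' V)) ∧
  ∀ (V : Set Y) (f : Y → K), IsOpen[Q.zariski] V → Q.IsRegular V f →
    P.IsRegular (φ ⁻¹' V) (fun x => f (φ x))

/-- Two spaces with functions are isomorphic. -/
def Isomorphic (P : SpaceWithFunctions K X) (Q : SpaceWithFunctions K Y) : Prop :=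
  ∃ φ : X ≃ Y, P.IsMorphism Q φ ∧ Q.IsMorphism P φ.symm

/-- The structure induced on a subset: the subspace topology, and the functions that are locally
restrictions of regular functions on open subsets of the ambient space. -/
def induced (P : SpaceWithFunctions K X) (S : Set X) : SpaceWithFunctions K S where
  zariski := TopologicalSpace.induced Subtype.val P.zariski
  IsRegular V f := ∀ y ∈ V, ∃ (U : Set X) (g : X → K), IsOpen[P.zariski] U ∧ (y : X) ∈ U ∧
    P.IsRegular U g ∧ ∀ z ∈ V, (z : X) ∈ U → f z = g z
  congr := by
    intro V f g hfg hf y hy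
    obtain ⟨U, h, hU, hyU, hh, he⟩ := hf y hy
    exact ⟨U, h, hU, hyU, hh, fun z hz hzU => (hfg hz).symm.trans (he z hz hzU)⟩
  mono := by
    intro V W f hWV hf y hy
    obtain ⟨U, h, hU, hyU, hh, he⟩ := hf y (hWV hy)
    exact ⟨U, h, hU, hyU, hh, fun z hz hzU => he z (hWV hz) hzU⟩
  glue := by
    intro V f hf y hy
    obtain ⟨W, ⟨W', hW', rfl⟩, hyW, hr⟩ := hf y hy
    obtain ⟨U, h, hU, hyU, hh, he⟩ := hr y ⟨hy, hyW⟩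
    exact ⟨U ∩ W', h, P.zariski.isOpen_inter _ _ hU hW', ⟨hyU, hyW⟩,
      P.mono Set.inter_subset_left hh, fun z hz hzU => he z ⟨hz, hzU.2⟩ hzU.1⟩
  const := by
    intro V c y _
    exact ⟨Set.univ, fun _ => c, @isOpen_univ X P.zariski, trivial, P.const _ c, fun _ _ _ => rfl⟩
  add := by
    intro V f g hf hg y hy
    obtain ⟨U, h, hU, hyU, hh, he⟩ := hf y hy
    obtain ⟨U', h', hU', hyU', hh', he'⟩ := hg y hy
    exact ⟨U ∩ U', _, P.zariski.isOpen_inter _ _ hU hU', ⟨hyU, hyU'⟩,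
      P.add (P.mono Set.inter_subset_left hh) (P.mono Set.inter_subset_right hh'),
      fun z hz hzU => by simp only [he z hz hzU.1, he' z hz hzU.2]⟩
  mul := by
    intro V f g hf hg y hy
    obtain ⟨U, h, hU, hyU, hh, he⟩ := hf y hy
    obtain ⟨U', h', hU', hyU', hh', he'⟩ := hg y hy
    exact ⟨U ∩ U', _, P.zariski.isOpen_inter _ _ hU hU', ⟨hyU, hyU'⟩,
      P.mul (P.mono Set.inter_subset_left hh) (P.mono Set.inter_subset_right hh'),
      fun z hz hzU => by simp only [he z hz hzU.1, he' z hz hzU.2]⟩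
  isOpen_ne_zero := by
    intro V f hV hf
    let _ : TopologicalSpace S := TopologicalSpace.induced Subtype.val P.zariski
    refine isOpen_iff_forall_mem_open.2 ?_
    rintro y ⟨hy, hfy⟩
    obtain ⟨U, h, hU, hyU, hh, he⟩ := hf y hy
    refine ⟨V ∩ Subtype.val ⁻¹' {x | x ∈ U ∧ h x ≠ 0}, ?_, ?_, ?_⟩
    · rintro z ⟨hz, hzU, hz0⟩
      exact ⟨hz, by rwa [he z hz hzU]⟩
    · exact IsOpen.inter hV ⟨_, P.isOpen_ne_zero hU hh, rfl⟩
    · exact ⟨hy, hyU, by rwa [← he y hy hyU]⟩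
  inv := by
    intro V f hf y hy
    obtain ⟨U, h, hU, hyU, hh, he⟩ := hf y hy.1
    refine ⟨{x | x ∈ U ∧ h x ≠ 0}, _, P.isOpen_ne_zero hU hh, ⟨hyU, ?_⟩, P.inv hh, ?_⟩
    · rw [← he y hy.1 hyU]
      exact hy.2
    · intro z hz hzU
      simp only [he z hz.1 hzU.1]

/-- The quotient structure along a map `π : X → Y`: a set is open, and a function on it is
regular, if this holds for the pullback to `X`. If `π` is bijective this is transport of structure.
-/
def coinduced (P : SpaceWithFunctions K X) (π : X → Y) : SpaceWithFunctions K Y where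
  zariski := TopologicalSpace.coinduced π P.zariski
  IsRegular V f := P.IsRegular (π ⁻¹' V) (fun x => f (π x))
  congr := fun hfg hf => P.congr (fun _ hx => hfg hx) hf
  mono := fun hVU hf => P.mono (Set.preimage_mono hVU) hf
  glue := by
    intro U f hf
    refine P.glue fun x hx => ?_
    obtain ⟨V, hV, hxV, hr⟩ := hf (π x) hx
    exact ⟨π ⁻¹' V, hV, hxV, hr⟩
  const := fun U c => P.const _ c
  add := fun hf hg => P.add hf hg
  mul := fun hf hg => P.mul hf hg
  isOpen_ne_zero := fun hU hf => P.isOpen_ne_zero hU hf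
  inv := fun hf => P.inv hf

/-- Affine space `K^σ`: the sets `{x | p(x) ≠ 0}` for polynomials `p` are a basis of the Zariski
topology, and the regular functions are those that are locally quotients of polynomials. -/
noncomputable def affineSpace (K : Type*) [Field K] (σ : Type*) :
    SpaceWithFunctions K (σ → K) where
  zariski :=
    { IsOpen := fun U => ∀ x ∈ U, ∃ p : MvPolynomial σ K, MvPolynomial.eval x p ≠ 0 ∧
        ∀ y, MvPolynomial.eval y p ≠ 0 → y ∈ U
      isOpen_univ := fun _ _ => ⟨1, by simp, fun _ _ => trivial⟩
      isOpen_inter := by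
        rintro U V hU hV x ⟨hxU, hxV⟩
        obtain ⟨p, hp, hpU⟩ := hU x hxU
        obtain ⟨q, hq, hqV⟩ := hV x hxV
        refine ⟨p * q, by simp [hp, hq], fun y hy => ?_⟩
        rw [map_mul] at hy
        exact ⟨hpU y (left_ne_zero_of_mul hy), hqV y (right_ne_zero_of_mul hy)⟩
      isOpen_sUnion := by
        rintro S hS x ⟨U, hU, hxU⟩
        obtain ⟨p, hp, hpU⟩ := hS U hU x hxU
        exact ⟨p, hp, fun y hy => ⟨U, hU, hpU y hy⟩⟩ }
  IsRegular U f := ∀ x ∈ U, ∃ p q : MvPolynomial σ K, MvPolynomial.eval x q ≠ 0 ∧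
    ∀ y ∈ U, MvPolynomial.eval y q ≠ 0 → f y = MvPolynomial.eval y p / MvPolynomial.eval y q
  congr := by
    intro U f g hfg hf x hx
    obtain ⟨p, q, hq, h⟩ := hf x hx
    exact ⟨p, q, hq, fun y hy hqy => (hfg hy).symm.trans (h y hy hqy)⟩
  mono := by
    intro U V f hVU hf x hx
    obtain ⟨p, q, hq, h⟩ := hf x (hVU hx)
    exact ⟨p, q, hq, fun y hy hqy => h y (hVU hy) hqy⟩
  glue := by
    intro U f hf x hx
    obtain ⟨V, hV, hxV, hr⟩ := hf x hx
    obtain ⟨p, q, hq, h⟩ := hr x ⟨hx, hxV⟩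
    obtain ⟨s, hs, hsV⟩ := hV x hxV
    refine ⟨p * s, q * s, by simp [hq, hs], fun y hy hqy => ?_⟩
    rw [map_mul] at hqy
    have hsy := right_ne_zero_of_mul hqy
    rw [h y ⟨hy, hsV y hsy⟩ (left_ne_zero_of_mul hqy), map_mul, map_mul,
      mul_div_mul_right _ _ hsy]
  const := fun U c x _ => ⟨MvPolynomial.C c, 1, by simp, by simp⟩
  add := by
    intro U f g hf hg x hx
    obtain ⟨p, q, hq, h⟩ := hf x hx
    obtain ⟨p', q', hq', h'⟩ := hg x hx
    refine ⟨p * q' + q * p', q * q', by simp [hq, hq'], fun y hy hqy => ?_⟩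
    rw [map_mul] at hqy
    have h1 := left_ne_zero_of_mul hqy
    have h2 := right_ne_zero_of_mul hqy
    simp only [h y hy h1, h' y hy h2, map_mul, map_add]
    exact div_add_div _ _ h1 h2
  mul := by
    intro U f g hf hg x hx
    obtain ⟨p, q, hq, h⟩ := hf x hx
    obtain ⟨p', q', hq', h'⟩ := hg x hx
    refine ⟨p * p', q * q', by simp [hq, hq'], fun y hy hqy => ?_⟩
    rw [map_mul] at hqy
    simp only [h y hy (left_ne_zero_of_mul hqy), h' y hy (right_ne_zero_of_mul hqy), map_mul]
    exact div_mul_div_comm _ _ _ _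
  isOpen_ne_zero := by
    rintro U f hU hf x ⟨hx, hfx⟩
    obtain ⟨p, q, hq, h⟩ := hf x hx
    obtain ⟨s, hs, hsU⟩ := hU x hx
    have hp : MvPolynomial.eval x p ≠ 0 := by
      intro h0
      exact hfx (by rw [h x hx hq, h0, zero_div])
    refine ⟨p * q * s, by simp [hp, hq, hs], fun y hy => ?_⟩
    rw [map_mul, map_mul] at hy
    have hyU := hsU y (right_ne_zero_of_mul hy)
    have h1 := left_ne_zero_of_mul hy
    refine ⟨hyU, ?_⟩
    rw [h y hyU (right_ne_zero_of_mul h1)]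
    exact div_ne_zero (left_ne_zero_of_mul h1) (right_ne_zero_of_mul h1)
  inv := by
    rintro U f hf x ⟨hx, hfx⟩
    obtain ⟨p, q, hq, h⟩ := hf x hx
    have hp : MvPolynomial.eval x p ≠ 0 := by
      intro h0
      exact hfx (by rw [h x hx hq, h0, zero_div])
    refine ⟨q * q, p * q, by simp [hp, hq], fun y hy hpq => ?_⟩
    rw [map_mul] at hpq
    have hqy := right_ne_zero_of_mul hpq
    simp only [h y hy.1 hqy, inv_div, map_mul]
    rw [mul_div_mul_right _ _ hqy]

/-- The affine space of all `m × n` matrices. -/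
noncomputable def matrixSpace (K : Type*) [Field K] (m n : Type*) :
    SpaceWithFunctions K (Matrix m n K) :=
  (affineSpace K (m × n)).coinduced (fun x => Matrix.of (fun i j => x (i, j)))

/-- `∅ = F 0 ⊂ F 1 ⊂ ⋯ ⊂ F m = X` is an affine paving whose cells are the sets `cell c`, `c : ι`:
the `F i` are closed, and each difference `F (i + 1) - F i` is, as a variety, the disjoint union of
the cells of level `i`, that is, these cells are pairwise disjoint, have the difference as their
union, and are relatively open in it; every cell is isomorphic to an affine space. -/
structure IsAffinePaving (P : SpaceWithFunctions K X) {ι : Type*} (cell : ι → Set X) {m : ℕ}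
    (F : Fin (m + 1) → Set X) : Prop where
  zero : F 0 = ∅
  last : F (Fin.last m) = Set.univ
  strictMono : StrictMono F
  isClosed : ∀ i, IsClosed[P.zariski] (F i)
  disjoint : ∀ c d, c ≠ d → Disjoint (cell c) (cell d)
  levels : ∃ level : ι → Fin m,
    (∀ i : Fin m, F i.succ \ F i.castSucc = {x | ∃ c, level c = i ∧ x ∈ cell c}) ∧
    ∀ c, ∃ O : Set X, IsOpen[P.zariski] O ∧
      cell c = O ∩ (F (level c).succ \ F (level c).castSucc)
  affine : ∀ c, ∃ N : ℕ, (affineSpace K (Fin N)).Isomorphic (P.induced (cell c))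

end SpaceWithFunctions

namespace GrassmannProduct

/-- The columns of a block matrix `(A_1 | ⋯ | A_r)` whose block `A_t` has `α t` columns. -/
abbrev Cols {r : ℕ} (α : Fin r → ℕ) : Type := Σ t : Fin r, Fin (α t)

/-- The span of the columns in block `t`. -/
def blockSpan {K : Type*} [Field K] {r k : ℕ} {α : Fin r → ℕ} (A : Matrix (Fin k) (Cols α) K)
    (t : Fin r) : Submodule K (Fin k → K) :=
  Submodule.span K (Set.range fun c : Fin (α t) => fun i : Fin k => A i ⟨t, c⟩)

/-- Block matrices each of whose blocks `A_t`, of size `k × α t`, has full rank `α t`. -/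
def fullRankBlocks (K : Type*) [Field K] {r : ℕ} (α : Fin r → ℕ) (k : ℕ) :
    Set (Matrix (Fin k) (Cols α) K) :=
  {A | ∀ t : Fin r, (A.submatrix id (Sigma.mk t)).rank = α t}

/-- The points of the product of the Grassmannians of `α t`-dimensional subspaces of `K^k`. -/
abbrev Gr (K : Type*) [Field K] {r : ℕ} (α : Fin r → ℕ) (k : ℕ) : Type _ :=
  (t : Fin r) → {W : Submodule K (Fin k → K) // Module.finrank K W = α t}

theorem finrank_blockSpan {K : Type*} [Field K] {r : ℕ} {α : Fin r → ℕ} {k : ℕ}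
    (A : fullRankBlocks K α k) (t : Fin r) : Module.finrank K (blockSpan A.1 t) = α t :=
  (Matrix.rank_eq_finrank_span_cols (A.1.submatrix id (Sigma.mk t))).symm.trans (A.2 t)

/-- The point of the Grassmann product represented by a block matrix: take column spaces. -/
def toGr {K : Type*} [Field K] {r : ℕ} {α : Fin r → ℕ} {k : ℕ} (A : fullRankBlocks K α k) :
    Gr K α k :=
  fun t => ⟨blockSpan A.1 t, finrank_blockSpan A t⟩

/-- The Grassmann product as an algebraic variety: the quotient of the open set of matrices
with full rank blocks by the action of `GL_{α_1} × ⋯ × GL_{α_r}` on columns (the fibres of `toGr`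
are the orbits). -/
noncomputable def variety (K : Type*) [Field K] {r : ℕ} (α : Fin r → ℕ) (k : ℕ) :
    SpaceWithFunctions K (Gr K α k) :=
  ((SpaceWithFunctions.matrixSpace K (Fin k) (Cols α)).induced (fullRankBlocks K α k)).coinduced
    toGr

/-- The spanning configurations `W_1 + ⋯ + W_r = K^k`. -/
def spanning (K : Type*) [Field K] {r : ℕ} (α : Fin r → ℕ) (k : ℕ) : Set (Gr K α k) :=
  {W | ⨆ t, (W t).1 = ⊤}

/-- Set sequences of type `α` in `[k]`. -/
structure SetSequence {r : ℕ} (α : Fin r → ℕ) (k : ℕ) where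
  sets : Fin r → Finset (Fin k)
  nonempty : ∀ t, (sets t).Nonempty
  card : ∀ t, (sets t).card = α t

namespace SetSequence

variable {r : ℕ} {α : Fin r → ℕ} {k : ℕ} (I : SetSequence α k)

/-- `I_1 ∪ ⋯ ∪ I_r = [k]`. -/
def Covers : Prop := ∀ i : Fin k, ∃ t, i ∈ I.sets t

/-- The union of the sets strictly before position `t`. -/
def before (t : Fin r) : Finset (Fin k) := (Finset.univ.filter (· < t)).biUnion I.sets

/-- Row `i` is listed before row `j` in the one-line notation of the permutation `π^(t)`, which lists
the elements outside `before t` increasingly and then the elements of `before t` increasingly. -/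
abbrev Precedes (t : Fin r) (i j : Fin k) : Prop :=
  (i ∉ I.before t ∧ j ∈ I.before t) ∨ ((i ∈ I.before t ↔ j ∈ I.before t) ∧ i < j)

/-- The lower unitriangular matrices whose entry in row `i` and column `j < i` vanishes unless
there is a `t` such that `j` is new in `I_t` and `i` is not in `I_1 ∪ ⋯ ∪ I_t`. -/
def unipotent (K : Type*) [Field K] : Set (Matrix (Fin k) (Fin k) K) :=
  {u | (∀ i, u i i = 1) ∧ (∀ i j, i < j → u i j = 0) ∧
    ∀ i j, j < i → (¬ ∃ t, (j ∈ I.sets t ∧ j ∉ I.before t) ∧ i ∉ I.before t ∧ i ∉ I.sets t) →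
      u i j = 0}

end SetSequence

/-- The symbols `0`, `1`, `⋆`. -/
inductive PatternSymbol : Type where
  | zero : PatternSymbol
  | one : PatternSymbol
  | star : PatternSymbol

/-- An element of the field may replace the symbol. -/
def PatternSymbol.Fits {K : Type*} [Field K] : PatternSymbol → K → Prop
  | .zero, x => x = 0
  | .one, x => x = 1
  | .star, _ => True

namespace SetSequence

variable {r : ℕ} {α : Fin r → ℕ} {k : ℕ} (I : SetSequence α k)

/-- The symbol of the pattern matrix in row `j` of the column of block `t` with pivot in row `i`.
The first three cases and the last one describe the column echelon form for the row order `π^(t)`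
with pivot rows `I_t`; the fourth case replaces certain stars by zeros. -/
def symbol (t : Fin r) (i j : Fin k) : PatternSymbol :=
  if j = i then .one
  else if j ∈ I.sets t then .zero
  else if I.Precedes t j i then .zero
  else if i ∉ I.before t ∧ j ∉ I.before t ∧ i < j then .zero
  else .star

/-- `p` lists the pivot rows `I_t` of block `t` from left to right, in the order of `π^(t)`. -/
def IsPivotList (t : Fin r) (p : Fin (α t) → Fin k) : Prop :=
  (∀ i, i ∈ I.sets t ↔ ∃ c, p c = i) ∧ ∀ c d, c < d → I.Precedes t (p c) (p d)

/-- The matrix `B` fits the pattern of `I` (the pivot lists are uniquely determined by `I`). -/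
def FitsPattern {K : Type*} [Field K] (B : Matrix (Fin k) (Cols α) K) : Prop :=
  ∀ t : Fin r, ∃ p : Fin (α t) → Fin k, I.IsPivotList t p ∧
    ∀ (c : Fin (α t)) (j : Fin k), (I.symbol t (p c) j).Fits (B j ⟨t, c⟩)

/-- The cell `C_I`: the image in the Grassmann product of the set of all `u * B` with `u` in
`unipotent I` and `B` fitting the pattern of `I`. -/
def cell (K : Type*) [Field K] : Set (Gr K α k) :=
  toGr '' {A | ∃ u ∈ I.unipotent K, ∃ B, I.FitsPattern B ∧ A.1 = u * B}

end SetSequence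

end GrassmannProduct

/-! For a configuration W let S_n be the sum of the W_t with t < n (`partialSup`, indices from 0),
and let the pivots of a subspace be the leading positions of its nonzero vectors. The cell of I
turns out to be the set of those W for which S_n has pivots `I.upTo n` for every n and W_t ∩ S_t has
pivots I_t ∩ P_t for every t. These sets determine I, since I_t consists of I_t ∩ P_t and the pivots
of S_{t+1} that are not pivots of S_t. Disjointness follows. On the cell, W spans K^k exactly when
the pivots of S_r are all of [k], that is, when I covers.

That a point of the cell has these pivots: if B fits the pattern, its partial sums are coordinate
subspaces (`partialSup_blockSpan`), and a lower unitriangular u moves no leading position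
(`pivots_map`). Conversely, the reduced echelon vectors of the S_n at their pivots give u
(`exists_unipotent`), and reduced echelon vectors relative to u⁻¹S_t give B
(`mem_cell_setSequence`).

The pivot sets are encoded by ranks of sums of linear images of the W_t (`rankFn`). Such ranks are
lower semicontinuous, so the condition that all of them be at least their values on one cell is
open, and any other cell meeting it has a larger rank sum. This orders the cells into a chain of
closed sets (`exists_isAffinePaving`). As dim S_r is itself one of the ranks, it may be compared
first, which makes the covering cells an upper segment of the order.

The coordinates of a cell are the free entries of u and the stars of B. The inverse of this
parametrization is regular because u is obtained from the partial sums, and then B from u and A, by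
inverting matrices of regular functions. Local sections of the quotient map (`normalize`) carry
regularity from matrices to the Grassmann product (`regular_of_regular_pullback`). -/

namespace SpaceWithFunctions

variable {K : Type*} [Field K] {X Y Z : Type*}

/-! ### Algebra of regular functions -/

section Algebra

variable {Q : SpaceWithFunctions K Y} {U : Set Y}

theorem regular_sum {ι : Type*} (s : Finset ι) {f : ι → Y → K}
    (h : ∀ i ∈ s, Q.IsRegular U (f i)) : Q.IsRegular U (fun y => ∑ i ∈ s, f i y) := by
  classical
  induction s using Finset.induction_on with
  | empty => simpa using Q.const U 0
  | insert a s ha ih =>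
    simp only [Finset.sum_insert ha]
    exact Q.add (h a (Finset.mem_insert_self _ _))
      (ih fun i hi => h i (Finset.mem_insert_of_mem hi))

theorem regular_prod {ι : Type*} (s : Finset ι) {f : ι → Y → K}
    (h : ∀ i ∈ s, Q.IsRegular U (f i)) : Q.IsRegular U (fun y => ∏ i ∈ s, f i y) := by
  classical
  induction s using Finset.induction_on with
  | empty => simpa using Q.const U 1
  | insert a s ha ih =>
    simp only [Finset.prod_insert ha]
    exact Q.mul (h a (Finset.mem_insert_self _ _))
      (ih fun i hi => h i (Finset.mem_insert_of_mem hi))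

theorem regular_eval {σ : Type*} {φ : Y → σ → K} (h : ∀ s, Q.IsRegular U (fun y => φ y s))
    (p : MvPolynomial σ K) : Q.IsRegular U (fun y => MvPolynomial.eval (φ y) p) := by
  induction p using MvPolynomial.induction_on with
  | C a => simpa using Q.const U a
  | add p q hp hq => simpa using Q.add hp hq
  | mul_X p n hp => simpa using Q.mul hp (h n)

/-- Matrices of regular functions. -/
def IsRegularMatrix (Q : SpaceWithFunctions K Y) (U : Set Y) {m n : Type*}
    (M : Y → Matrix m n K) : Prop :=
  ∀ i j, Q.IsRegular U (fun y => M y i j)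

theorem IsRegularMatrix.const {m n : Type*} (M : Matrix m n K) :
    Q.IsRegularMatrix U (fun _ => M) := fun _ _ => Q.const U _

theorem IsRegularMatrix.mono {m n : Type*} {M : Y → Matrix m n K} {V : Set Y} (hV : V ⊆ U)
    (h : Q.IsRegularMatrix U M) : Q.IsRegularMatrix V M := fun i j => Q.mono hV (h i j)

theorem IsRegularMatrix.mul {l m n : Type*} [Fintype m] {M : Y → Matrix l m K}
    {N : Y → Matrix m n K} (hM : Q.IsRegularMatrix U M) (hN : Q.IsRegularMatrix U N) :
    Q.IsRegularMatrix U (fun y => M y * N y) := fun i j => by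
  simp only [Matrix.mul_apply]
  exact regular_sum _ fun a _ => Q.mul (hM i a) (hN a j)

theorem IsRegularMatrix.submatrix {l m n o : Type*} {M : Y → Matrix l m K}
    (hM : Q.IsRegularMatrix U M) (e : n → l) (f : o → m) :
    Q.IsRegularMatrix U (fun y => (M y).submatrix e f) := fun i j => hM (e i) (f j)

theorem IsRegularMatrix.det {n : Type*} [Fintype n] [DecidableEq n] {M : Y → Matrix n n K}
    (hM : Q.IsRegularMatrix U M) : Q.IsRegular U (fun y => (M y).det) := by
  simp only [Matrix.det_apply']
  exact regular_sum _ fun σ _ => Q.mul (Q.const U _) (regular_prod _ fun i _ => hM _ _)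

theorem regular_inv {f : Y → K} (hf : Q.IsRegular U f) (h0 : ∀ y ∈ U, f y ≠ 0) :
    Q.IsRegular U (fun y => (f y)⁻¹) :=
  Q.mono (U := {y | y ∈ U ∧ f y ≠ 0}) (fun y hy => ⟨hy, h0 y hy⟩) (Q.inv hf)

theorem IsRegularMatrix.inv {n : Type*} [Fintype n] [DecidableEq n] {M : Y → Matrix n n K}
    (hM : Q.IsRegularMatrix U M) (h0 : ∀ y ∈ U, (M y).det ≠ 0) :
    Q.IsRegularMatrix U (fun y => (M y)⁻¹) := fun i j => by
  simp only [Matrix.inv_def, Matrix.smul_apply, Ring.inverse_eq_inv', smul_eq_mul,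
    Matrix.adjugate_apply]
  refine Q.mul (regular_inv hM.det h0) (IsRegularMatrix.det fun a b => ?_)
  by_cases ha : a = j
  · subst ha
    simpa using Q.const U _
  · simpa [Matrix.updateRow_ne ha] using hM a b

end Algebra

/-! ### Morphisms -/

theorem isOpen_inter_preimage {σ : Type*} {Q : SpaceWithFunctions K Y} {U : Set Y}
    (hU : IsOpen[Q.zariski] U) {φ : Y → σ → K} (h : ∀ s, Q.IsRegular U (fun y => φ y s))
    {V : Set (σ → K)} (hV : IsOpen[(affineSpace K σ).zariski] V) :
    IsOpen[Q.zariski] (U ∩ φ ⁻¹' V) := by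
  let _ : TopologicalSpace Y := Q.zariski
  refine isOpen_iff_forall_mem_open.2 ?_
  rintro y ⟨hyU, hyV⟩
  obtain ⟨p, hp, hpV⟩ := hV _ hyV
  exact ⟨_, fun z hz => ⟨hz.1, hpV _ hz.2⟩, Q.isOpen_ne_zero hU (regular_eval h p), hyU, hp⟩

theorem regular_comp {σ : Type*} {Q : SpaceWithFunctions K Y} {U : Set Y}
    (hU : IsOpen[Q.zariski] U) {φ : Y → σ → K} (h : ∀ s, Q.IsRegular U (fun y => φ y s))
    {V : Set (σ → K)} {f : (σ → K) → K} (hf : (affineSpace K σ).IsRegular V f) :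
    Q.IsRegular (U ∩ φ ⁻¹' V) (fun y => f (φ y)) := by
  refine Q.glue ?_
  rintro y ⟨hyU, hyV⟩
  obtain ⟨p, q, hq, hpq⟩ := hf _ hyV
  refine ⟨_, Q.isOpen_ne_zero hU (regular_eval h q), ⟨hyU, hq⟩, ?_⟩
  refine Q.congr ?_ (Q.mul (Q.mono ?_ (regular_eval h p)) (Q.mono ?_ (Q.inv (regular_eval h q))))
  · rintro z ⟨⟨_, hzV⟩, _, hz⟩
    simp only [hpq _ hzV hz, div_eq_mul_inv]
  · rintro z ⟨⟨hz, _⟩, _⟩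
    exact hz
  · rintro z ⟨_, hz⟩
    exact hz

theorem isMorphism_affineSpace {σ : Type*} {Q : SpaceWithFunctions K Y} {φ : Y → σ → K}
    (h : ∀ s, Q.IsRegular Set.univ (fun y => φ y s)) : Q.IsMorphism (affineSpace K σ) φ := by
  let _ : TopologicalSpace Y := Q.zariski
  constructor
  · intro V hV
    simpa using isOpen_inter_preimage (Q := Q) isOpen_univ h hV
  · intro V f _ hf
    simpa using regular_comp (Q := Q) isOpen_univ h hf

theorem IsMorphism.comp {P : SpaceWithFunctions K X} {Q : SpaceWithFunctions K Y}
    {R : SpaceWithFunctions K Z} {ψ : Y → Z} {φ : X → Y} (hψ : Q.IsMorphism R ψ)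
    (hφ : P.IsMorphism Q φ) : P.IsMorphism R (ψ ∘ φ) :=
  ⟨fun V hV => hφ.1 _ (hψ.1 V hV), fun V f hV hf => hφ.2 _ _ (hψ.1 V hV) (hψ.2 V f hV hf)⟩

theorem Isomorphic.trans {P : SpaceWithFunctions K X} {Q : SpaceWithFunctions K Y}
    {R : SpaceWithFunctions K Z} (h : P.Isomorphic Q) (h' : Q.Isomorphic R) : P.Isomorphic R := by
  obtain ⟨φ, h1, h2⟩ := h
  obtain ⟨ψ, h3, h4⟩ := h'
  exact ⟨φ.trans ψ, h3.comp h1, h2.comp h4⟩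

theorem isMorphism_coinduced (P : SpaceWithFunctions K X) (π : X → Y) :
    P.IsMorphism (P.coinduced π) π :=
  ⟨fun _ hV => hV, fun _ _ _ hf => hf⟩

theorem IsMorphism.codRestrict {P : SpaceWithFunctions K X} {Q : SpaceWithFunctions K Y}
    {S : Set Y} {φ : X → S} (h : P.IsMorphism Q (fun x => (φ x : Y))) :
    P.IsMorphism (Q.induced S) φ := by
  constructor
  · rintro V ⟨W, hW, rfl⟩
    exact h.1 W hW
  · intro V f _ hf
    refine P.glue fun x hx => ?_
    obtain ⟨U, g, hU, hxU, hg, he⟩ := hf _ hx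
    refine ⟨_, h.1 U hU, hxU, P.congr ?_ (P.mono Set.inter_subset_right (h.2 U g hU hg))⟩
    rintro z ⟨hzV, hzU⟩
    exact (he _ hzV hzU).symm

theorem isMorphism_val (P : SpaceWithFunctions K X) (S : Set X) :
    (P.induced S).IsMorphism P Subtype.val :=
  ⟨fun V hV => ⟨V, hV, rfl⟩, fun V f hV hf _ hy => ⟨V, f, hV, hy, hf, fun _ _ _ => rfl⟩⟩

theorem regular_coord {σ : Type*} (U : Set (σ → K)) (s : σ) :
    (affineSpace K σ).IsRegular U (fun x => x s) :=
  fun x _ => ⟨MvPolynomial.X s, 1, by simp, by simp⟩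

theorem affineSpace_isomorphic {σ τ : Type*} (e : σ ≃ τ) :
    (affineSpace K τ).Isomorphic (affineSpace K σ) :=
  ⟨(Equiv.arrowCongr e (Equiv.refl K)).symm, isMorphism_affineSpace fun _ => regular_coord _ _,
    isMorphism_affineSpace fun _ => regular_coord _ _⟩

theorem isMorphism_matrixSpace {m n : Type*} {Q : SpaceWithFunctions K Y} {M : Y → Matrix m n K}
    (h : Q.IsRegularMatrix Set.univ M) : Q.IsMorphism (matrixSpace K m n) M :=
  (isMorphism_coinduced (affineSpace K (m × n)) _).comp
    (isMorphism_affineSpace (φ := fun y ij => M y ij.1 ij.2) fun ij => h ij.1 ij.2)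

theorem isRegularMatrix_induced {m n : Type*} (S : Set (Matrix m n K)) (U : Set S) :
    ((matrixSpace K m n).induced S).IsRegularMatrix U (fun A => A.1) := fun i j => by
  refine SpaceWithFunctions.mono _ (Set.subset_univ U) ?_
  exact (isMorphism_val (matrixSpace K m n) S).2 Set.univ (fun A => A i j)
    (@isOpen_univ _ (matrixSpace K m n).zariski) (regular_coord (σ := m × n) _ (i, j))

/-! ### A criterion for affine pavings -/

/-- Let F i be the union of the cells of level below i. Its complement is the union of the open sets
O c over the cells of level at least i, because O c meets only the cell of c and cells of higher
level. Inside one level, O c cuts out the cell of c alone. -/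
theorem exists_isAffinePaving (P : SpaceWithFunctions K X) {ι Λ : Type*} [Finite ι]
    [LinearOrder Λ] (cell : ι → Set X) (L : ι → Λ) (hne : ∀ c, (cell c).Nonempty)
    (hdisj : ∀ c d, c ≠ d → Disjoint (cell c) (cell d)) (hcov : ∀ x, ∃ c, x ∈ cell c)
    (haff : ∀ c, ∃ N : ℕ, (affineSpace K (Fin N)).Isomorphic (P.induced (cell c)))
    (hopen : ∀ c, ∃ O : Set X, IsOpen[P.zariski] O ∧ cell c ⊆ O ∧
      ∀ d, ∀ x ∈ O, x ∈ cell d → d = c ∨ L c < L d) :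
    ∃ (m : ℕ) (F : Fin (m + 1) → Set X), P.IsAffinePaving cell F ∧
      ∀ a : Λ, ∃ i, {x | ∃ c, x ∈ cell c ∧ a ≤ L c} = (F i)ᶜ := by
  classical
  have := Fintype.ofFinite ι
  -- Only values that `L` attains become indices of the chain, so every difference contains a
  -- nonempty cell and the chain is strict.
  let T : Finset Λ := Finset.univ.image L
  have hT : ∀ c, L c ∈ T := fun c => Finset.mem_image_of_mem _ (Finset.mem_univ _)
  let e := T.orderIsoOfFin rfl
  let level : ι → Fin T.card := fun c => e.symm ⟨L c, hT c⟩
  have hlt : ∀ c d, L c < L d ↔ level c < level d := fun c d => by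
    simp only [level, OrderIso.lt_iff_lt, Subtype.mk_lt_mk]
  have hsurj : ∀ i, ∃ c, level c = i := fun i => by
    obtain ⟨c, -, hc⟩ := Finset.mem_image.1 (e i).2
    refine ⟨c, ?_⟩
    simp only [level, OrderIso.symm_apply_eq]
    exact Subtype.ext hc
  have huniq : ∀ {x c d}, x ∈ cell c → x ∈ cell d → c = d := fun {x c d} hc hd => by
    by_contra h
    exact Set.disjoint_left.1 (hdisj c d h) hc hd
  choose O hO hcO hOd using hopen
  let F : Fin (T.card + 1) → Set X := fun i => {x | ∃ c, (level c).castSucc < i ∧ x ∈ cell c}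
  have hmem : ∀ {x c}, x ∈ cell c → ∀ i, x ∈ F i ↔ (level c).castSucc < i := fun {x c} hx i =>
    ⟨fun ⟨d, hd, hxd⟩ => by rwa [huniq hx hxd], fun h => ⟨c, h, hx⟩⟩
  have hcompl : ∀ i, (F i)ᶜ = ⋃ c ∈ {c | i ≤ (level c).castSucc}, O c := fun i => by
    ext x
    obtain ⟨d, hd⟩ := hcov x
    simp only [Set.mem_compl_iff, hmem hd, not_lt, Set.mem_iUnion, Set.mem_ofPred_eq, exists_prop]
    constructor
    · exact fun h => ⟨d, h, hcO d hd⟩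
    · rintro ⟨c, hc, hxc⟩
      rcases hOd c d x hxc hd with rfl | h
      · exact hc
      · exact hc.trans (Fin.castSucc_lt_castSucc_iff.2 ((hlt c d).1 h)).le
  have hdiff : ∀ {x c}, x ∈ cell c → ∀ i : Fin T.card,
      x ∈ F i.succ \ F i.castSucc ↔ level c = i := fun {x c} hx i => by
    rw [Set.mem_sdiff, hmem hx, hmem hx]
    simp only [Fin.lt_def, Fin.ext_iff, Fin.val_castSucc, Fin.val_succ]
    omega
  refine ⟨T.card, F, ⟨?_, ?_, ?_, ?_, hdisj, ⟨level, ?_, ?_⟩, haff⟩, ?_⟩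
  · ext x
    simp [F]
  · refine Set.eq_univ_of_forall fun x => ?_
    obtain ⟨d, hd⟩ := hcov x
    exact (hmem hd _).2 (Fin.castSucc_lt_last _)
  · intro i j hij
    refine lt_of_le_of_ne ?_ fun h => ?_
    · rintro x ⟨c, hc, hx⟩
      exact ⟨c, hc.trans hij, hx⟩
    · obtain ⟨c, hc⟩ := hsurj (i.castLT (by have := j.2; rw [Fin.lt_def] at hij; omega))
      obtain ⟨x, hx⟩ := hne c
      have h1 := hmem hx i
      rw [h, hmem hx j, hc] at h1
      simp only [Fin.castSucc_castLT] at h1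
      exact lt_irrefl _ (h1.1 hij)
  · intro i
    let _ : TopologicalSpace X := P.zariski
    rw [← isOpen_compl_iff, hcompl]
    exact isOpen_biUnion fun c _ => hO c
  · intro i
    ext x
    obtain ⟨d, hd⟩ := hcov x
    rw [hdiff hd]
    constructor
    · exact fun h => ⟨d, h, hd⟩
    · rintro ⟨c, hc, hxc⟩
      rwa [huniq hd hxc]
  · intro c
    refine ⟨O c, hO c, ?_⟩
    ext x
    constructor
    · exact fun hx => ⟨hcO c hx, (hdiff hx _).2 rfl⟩
    · rintro ⟨hxO, hx⟩
      obtain ⟨d, hd⟩ := hcov x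
      rw [hdiff hd] at hx
      rcases hOd c d x hxO hd with rfl | h
      · exact hd
      · exact absurd ((hlt c d).1 h) (by simp [hx])
  · intro a
    have hL : ∀ c, L c = e (level c) := fun c => by simp [level]
    by_cases h : ∃ i : Fin T.card, a ≤ e i
    · have hex : ∃ n, ∃ h : n < T.card, a ≤ (e ⟨n, h⟩ : Λ) := by
        obtain ⟨i, hi⟩ := h
        exact ⟨i, i.2, hi⟩
      obtain ⟨hn, han⟩ := Nat.find_spec hex
      refine ⟨⟨Nat.find hex, by omega⟩, ?_⟩
      ext x
      obtain ⟨d, hd⟩ := hcov x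
      rw [Set.mem_compl_iff, hmem hd, not_lt, Set.mem_ofPred_eq]
      constructor
      · rintro ⟨c, hc, hac⟩
        obtain rfl := huniq hc hd
        exact Nat.find_min' hex ⟨(level c).2, by rw [hL] at hac; exact hac⟩
      · intro hle
        refine ⟨d, hd, han.trans ?_⟩
        rw [hL]
        exact e.monotone hle
    · push Not at h
      refine ⟨Fin.last _, ?_⟩
      ext x
      obtain ⟨d, hd⟩ := hcov x
      rw [Set.mem_compl_iff, hmem hd, Set.mem_ofPred_eq]
      simp only [Fin.castSucc_lt_last, not_true_eq_false, iff_false, not_exists, not_and, not_le]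
      intro c _
      rw [hL]
      exact h _

end SpaceWithFunctions

/-! ### Block matrices, local sections of the quotient map, semicontinuity of ranks -/

namespace GrassmannProduct

open SpaceWithFunctions Matrix

variable {K : Type*} [Field K] {r k : ℕ} {α : Fin r → ℕ}

/-- The block `A_t` of a block matrix. -/
abbrev block (A : Matrix (Fin k) (Cols α) K) (t : Fin r) : Matrix (Fin k) (Fin (α t)) K :=
  A.submatrix id (fun c : Fin (α t) => (⟨t, c⟩ : Cols α))

theorem blockSpan_eq_range (A : Matrix (Fin k) (Cols α) K) (t : Fin r) :
    blockSpan A t = LinearMap.range (block A t).mulVecLin :=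
  (Matrix.range_mulVecLin _).symm

theorem mem_blockSpan {A : Matrix (Fin k) (Cols α) K} {t : Fin r} {v : Fin k → K} :
    v ∈ blockSpan A t ↔ ∃ x, block A t *ᵥ x = v := by
  rw [blockSpan_eq_range]
  rfl

theorem mem_fullRankBlocks_iff {A : Matrix (Fin k) (Cols α) K} :
    A ∈ fullRankBlocks K α k ↔ ∀ t x, block A t *ᵥ x = 0 → x = 0 := by
  refine forall_congr' fun t => ?_
  have h := LinearMap.finrank_range_add_finrank_ker (block A t).mulVecLin
  rw [Module.finrank_fin_fun] at h
  change Module.finrank K (LinearMap.range (block A t).mulVecLin) = α t ↔ _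
  have h2 : LinearMap.ker (block A t).mulVecLin = ⊥ ↔ ∀ x, block A t *ᵥ x = 0 → x = 0 :=
    LinearMap.ker_eq_bot'
  rw [← h2, ← Submodule.finrank_eq_zero (R := K)]
  omega

theorem exists_leftInverse_matrix {m n : Type*} [Fintype m] [Fintype n] [DecidableEq m]
    [DecidableEq n] {M : Matrix m n K} (hM : ∀ x, M *ᵥ x = 0 → x = 0) :
    ∃ R : Matrix n m K, R * M = 1 := by
  obtain ⟨g, hg⟩ := LinearMap.exists_leftInverse_of_injective (Matrix.toLin' M)
    (LinearMap.ker_eq_bot'.2 hM)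
  refine ⟨LinearMap.toMatrix' g, ?_⟩
  conv_lhs => rw [← LinearMap.toMatrix'_toLin' M]
  rw [← LinearMap.toMatrix'_comp, hg, LinearMap.toMatrix'_id]

theorem exists_eq_mul_of_blockSpan_le {A A' : Matrix (Fin k) (Cols α) K} {t : Fin r}
    (h : blockSpan A' t ≤ blockSpan A t) :
    ∃ g : Matrix (Fin (α t)) (Fin (α t)) K, block A' t = block A t * g := by
  have : ∀ c, ∃ x, block A t *ᵥ x = fun i => A' i ⟨t, c⟩ := fun c =>
    mem_blockSpan.1 (h (Submodule.subset_span ⟨c, rfl⟩))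
  choose x hx using this
  refine ⟨Matrix.of fun i c => x c i, ?_⟩
  ext i c
  exact (congrFun (hx c) i).symm

theorem det_ne_zero_of_block_eq_mul {A A' : Matrix (Fin k) (Cols α) K} {t : Fin r}
    (hA' : A' ∈ fullRankBlocks K α k) {g : Matrix (Fin (α t)) (Fin (α t)) K}
    (h : block A' t = block A t * g) : g.det ≠ 0 := by
  refine fun h0 => ?_
  obtain ⟨x, hx, hgx⟩ := Matrix.exists_mulVec_eq_zero_iff.2 h0
  refine hx (mem_fullRankBlocks_iff.1 hA' t x ?_)
  rw [h, ← Matrix.mulVec_mulVec, hgx, Matrix.mulVec_zero]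

theorem toGr_surjective : Function.Surjective (toGr : fullRankBlocks K α k → Gr K α k) := by
  intro W
  let b := fun t => Module.finBasisOfFinrankEq K (W t).1 (W t).2
  let A : Matrix (Fin k) (Cols α) K := Matrix.of fun i c => (b c.1 c.2 : Fin k → K) i
  have hspan : ∀ t, blockSpan A t = (W t).1 := fun t => by
    have := congrArg (Submodule.map (W t).1.subtype) (b t).span_eq
    rw [Submodule.map_span, ← Set.range_comp, Submodule.map_top, Submodule.range_subtype] at this
    exact this
  have hA : A ∈ fullRankBlocks K α k := fun t => by
    rw [Matrix.rank_eq_finrank_span_cols]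
    exact (congrArg (fun V : Submodule K (Fin k → K) => Module.finrank K V) (hspan t)).trans (W t).2
  exact ⟨⟨A, hA⟩, funext fun t => Subtype.ext (hspan t)⟩

theorem toGr_eq_iff {A A' : fullRankBlocks K α k} :
    toGr A = toGr A' ↔ ∀ t, blockSpan A.1 t = blockSpan A'.1 t := by
  simp [toGr, funext_iff, Subtype.ext_iff]

/-- The ambient structure on the matrices with full rank blocks. -/
noncomputable abbrev fullRankSpace (K : Type*) [Field K] {r : ℕ} (α : Fin r → ℕ) (k : ℕ) :
    SpaceWithFunctions K (fullRankBlocks K α k) :=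
  (matrixSpace K (Fin k) (Cols α)).induced (fullRankBlocks K α k)

theorem isOpen_variety_iff {U : Set (Gr K α k)} :
    IsOpen[(variety K α k).zariski] U ↔ IsOpen[(fullRankSpace K α k).zariski] (toGr ⁻¹' U) :=
  Iff.rfl

theorem regular_variety_iff {U : Set (Gr K α k)} {f : Gr K α k → K} :
    (variety K α k).IsRegular U f ↔
      (fullRankSpace K α k).IsRegular (toGr ⁻¹' U) (fun A => f (toGr A)) :=
  Iff.rfl

/-- A matrix representing a point of the Grassmann product. -/
noncomputable def rep (W : Gr K α k) : fullRankBlocks K α k :=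
  Function.surjInv toGr_surjective W

theorem toGr_rep (W : Gr K α k) : toGr (rep W) = W :=
  Function.surjInv_eq toGr_surjective W

/-- The block matrix with blocks `A_t * g_t`. -/
def mulBlocks (A : Matrix (Fin k) (Cols α) K) (g : ∀ t, Matrix (Fin (α t)) (Fin (α t)) K) :
    Matrix (Fin k) (Cols α) K :=
  Matrix.of fun i c => (block A c.1 * g c.1) i c.2

theorem block_mulBlocks (A : Matrix (Fin k) (Cols α) K)
    (g : ∀ t, Matrix (Fin (α t)) (Fin (α t)) K) (t : Fin r) :
    block (mulBlocks A g) t = block A t * g t := rfl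

omit [Field K] in
theorem block_ext {A A' : Matrix (Fin k) (Cols α) K} (h : ∀ t, block A t = block A' t) :
    A = A' := by
  ext i ⟨t, c⟩
  exact congrFun (congrFun (h t) i) c

theorem blockSpan_mulBlocks (A : Matrix (Fin k) (Cols α) K)
    {g : ∀ t, Matrix (Fin (α t)) (Fin (α t)) K} {t : Fin r} (hg : (g t).det ≠ 0) :
    blockSpan (mulBlocks A g) t = blockSpan A t := by
  ext v
  simp only [mem_blockSpan, block_mulBlocks]
  constructor
  · rintro ⟨x, rfl⟩
    exact ⟨g t *ᵥ x, by rw [Matrix.mulVec_mulVec]⟩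
  · rintro ⟨x, rfl⟩
    refine ⟨(g t)⁻¹ *ᵥ x, ?_⟩
    rw [Matrix.mulVec_mulVec, Matrix.mul_assoc, Matrix.mul_nonsing_inv _ hg.isUnit, Matrix.mul_one]

theorem mulBlocks_mem {A : Matrix (Fin k) (Cols α) K} (hA : A ∈ fullRankBlocks K α k)
    {g : ∀ t, Matrix (Fin (α t)) (Fin (α t)) K} (hg : ∀ t, (g t).det ≠ 0) :
    mulBlocks A g ∈ fullRankBlocks K α k := fun t => by
  exact (Matrix.rank_eq_finrank_span_cols _).trans
    ((congrArg (fun V : Submodule K (Fin k → K) => Module.finrank K V)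
    (blockSpan_mulBlocks A (hg t))).trans (finrank_blockSpan ⟨A, hA⟩ t))

/-- Given row operations `R_t`, the representative `A_t (R_t A_t)⁻¹` of the class of `A`. -/
noncomputable def normalize (R : ∀ t, Matrix (Fin (α t)) (Fin k) K)
    (A : Matrix (Fin k) (Cols α) K) : Matrix (Fin k) (Cols α) K :=
  mulBlocks A fun t => (R t * block A t)⁻¹

theorem det_ne_zero_of_toGr_eq (R : ∀ t, Matrix (Fin (α t)) (Fin k) K)
    {A A' : fullRankBlocks K α k} (h : toGr A = toGr A') (t : Fin r)
    (hA : (R t * block A.1 t).det ≠ 0) : (R t * block A'.1 t).det ≠ 0 := by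
  obtain ⟨g, hg⟩ := exists_eq_mul_of_blockSpan_le (toGr_eq_iff.1 h t).ge
  have := det_ne_zero_of_block_eq_mul A'.2 hg
  rw [hg, ← Matrix.mul_assoc, Matrix.det_mul]
  exact mul_ne_zero hA this

/-- Passing from A_t to A_t g turns R_t A_t into R_t A_t g, and g cancels. So `normalize R` descends
to the quotient and gives a section of `toGr` over the locus where all R_t A_t are invertible. -/
theorem normalize_eq_of_toGr_eq (R : ∀ t, Matrix (Fin (α t)) (Fin k) K)
    {A A' : fullRankBlocks K α k} (h : toGr A = toGr A') :
    normalize R A.1 = normalize R A'.1 := by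
  refine block_ext fun t => ?_
  obtain ⟨g, hg⟩ := exists_eq_mul_of_blockSpan_le (toGr_eq_iff.1 h t).ge
  have hdet := det_ne_zero_of_block_eq_mul A'.2 hg
  rw [normalize, normalize, block_mulBlocks, block_mulBlocks, hg, ← Matrix.mul_assoc (R t),
    Matrix.mul_inv_rev, Matrix.mul_assoc, ← Matrix.mul_assoc g,
    Matrix.mul_nonsing_inv _ hdet.isUnit, Matrix.one_mul]

theorem normalize_mem (R : ∀ t, Matrix (Fin (α t)) (Fin k) K) (A : fullRankBlocks K α k)
    (hA : ∀ t, (R t * block A.1 t).det ≠ 0) : normalize R A.1 ∈ fullRankBlocks K α k := by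
  have hdet : ∀ t, ((R t * block A.1 t)⁻¹).det ≠ 0 := fun t =>
    (Matrix.isUnit_nonsing_inv_det _ (hA t).isUnit).ne_zero
  exact mulBlocks_mem A.2 hdet

theorem toGr_normalize (R : ∀ t, Matrix (Fin (α t)) (Fin k) K) (A : fullRankBlocks K α k)
    (hA : ∀ t, (R t * block A.1 t).det ≠ 0) (h : normalize R A.1 ∈ fullRankBlocks K α k) :
    toGr ⟨normalize R A.1, h⟩ = toGr A := by
  rw [toGr_eq_iff]
  intro t
  have hdet : ((R t * block A.1 t)⁻¹).det ≠ 0 :=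
    (Matrix.isUnit_nonsing_inv_det _ (hA t).isUnit).ne_zero
  exact blockSpan_mulBlocks A.1 (g := fun t => (R t * block A.1 t)⁻¹) hdet

theorem exists_leftInverse_blocks (A : fullRankBlocks K α k) :
    ∃ R : ∀ t, Matrix (Fin (α t)) (Fin k) K, ∀ t, R t * block A.1 t = 1 := by
  choose R hR using fun t => exists_leftInverse_matrix (mem_fullRankBlocks_iff.1 A.2 t)
  exact ⟨R, hR⟩

/-- A function on a subset `C` of the Grassmann product is regular if its pullback to matrices is
regular. -/
theorem regular_of_regular_pullback {C : Set (Gr K α k)} {f : C → K}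
    (h : ((fullRankSpace K α k).induced (toGr ⁻¹' C)).IsRegular Set.univ
      fun A => f ⟨toGr A.1, A.2⟩) :
    ((variety K α k).induced C).IsRegular Set.univ f := by
  rintro ⟨W₀, hW₀⟩ -
  obtain ⟨A₀, rfl⟩ := toGr_surjective W₀
  obtain ⟨U, g, hU, hAU, hg, hfg⟩ := h ⟨A₀, hW₀⟩ trivial
  -- With R_t a left inverse of the blocks of A₀, the local section passes through A₀ itself, where
  -- the pullback of f is known to be regular.
  obtain ⟨R, hR⟩ := exists_leftInverse_blocks A₀
  let Q := fullRankSpace K α k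
  have hreg : Q.IsRegularMatrix Set.univ (fun A => A.1) := isRegularMatrix_induced _ _
  let O : Set (fullRankBlocks K α k) := {A | ∀ t, (R t * block A.1 t).det ≠ 0}
  have hO : IsOpen[Q.zariski] O := by
    let _ := Q.zariski
    have : O = ⋂ t, {A | A ∈ Set.univ ∧ (R t * block A.1 t).det ≠ 0} := by
      ext A
      simp [O]
    rw [this]
    exact isOpen_iInter_of_finite fun t => Q.isOpen_ne_zero isOpen_univ
      (IsRegularMatrix.det (IsRegularMatrix.mul (IsRegularMatrix.const _) (hreg.submatrix _ _)))
  have hN : Q.IsRegularMatrix O (fun A => normalize R A.1) := fun i c =>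
    ((hreg.mono (Set.subset_univ _)).submatrix id (Sigma.mk c.1)).mul (IsRegularMatrix.inv
      (IsRegularMatrix.mul (IsRegularMatrix.const _)
        ((hreg.mono (Set.subset_univ _)).submatrix _ _)) fun A (hA : A ∈ O) => hA c.1) i c.2
  obtain ⟨U', hU', rfl⟩ := hU
  obtain ⟨U₁, g₁, hU₁, hA₁, hg₁, he₁⟩ := hg A₀ hAU
  let S : Set (Matrix (Fin k) (Cols α) K) := U' ∩ U₁
  have hS : IsOpen[(matrixSpace K (Fin k) (Cols α)).zariski] S :=
    (matrixSpace K (Fin k) (Cols α)).zariski.isOpen_inter _ _ hU' hU₁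
  -- The points whose normalized representative lies in S. The arbitrary choice made by `rep` is
  -- harmless, since both conditions are invariant under change of representative.
  let U₂ : Set (Gr K α k) := {W | rep W ∈ O ∧ normalize R (rep W).1 ∈ S}
  have hpre : toGr ⁻¹' U₂ =
      O ∩ {A : fullRankBlocks K α k | normalize R A.1 ∈ S} := by
    ext A
    have h1 : toGr (rep (toGr A)) = toGr A := toGr_rep _
    simp only [U₂, Set.mem_preimage, Set.mem_ofPred_eq, Set.mem_inter_iff,
      normalize_eq_of_toGr_eq R h1]
    refine and_congr_left fun _ => ⟨fun h t => ?_, fun h t => ?_⟩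
    · exact det_ne_zero_of_toGr_eq R h1 t (h t)
    · exact det_ne_zero_of_toGr_eq R h1.symm t (h t)
  have hA₀ : normalize R A₀.1 = A₀.1 := block_ext fun t => by
    rw [normalize, block_mulBlocks, hR]
    simp
  have hA₀O : A₀ ∈ O := fun t => by simp [hR]
  refine ⟨U₂, fun W => g₁ (normalize R (rep W).1),
    ?_, ?_, ?_, ?_⟩
  · rw [isOpen_variety_iff, hpre]
    exact isOpen_inter_preimage (φ := fun (A : fullRankBlocks K α k) (ij : Fin k × Cols α) =>
      normalize R A.1 ij.1 ij.2) hO (fun ij => hN ij.1 ij.2) hS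
  · have h3 : A₀ ∈ toGr ⁻¹' U₂ := by
      rw [hpre]
      exact ⟨hA₀O, by simpa [hA₀, S] using ⟨hAU, hA₁⟩⟩
    exact h3
  · rw [regular_variety_iff, hpre]
    have := regular_comp (φ := fun (A : fullRankBlocks K α k) (ij : Fin k × Cols α) =>
      normalize R A.1 ij.1 ij.2) hO (fun ij => hN ij.1 ij.2)
      ((matrixSpace K (Fin k) (Cols α)).mono Set.inter_subset_right hg₁ :
        (matrixSpace K (Fin k) (Cols α)).IsRegular S g₁)
    refine Q.congr (fun A _ => ?_) this
    change g₁ (normalize R A.1) = _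
    rw [normalize_eq_of_toGr_eq R (toGr_rep (toGr A))]
  · rintro ⟨W, hW⟩ - hWU
    have hWO : rep W ∈ O := hWU.1
    have hWS : normalize R (rep W).1 ∈ S := hWU.2
    have hmem := normalize_mem R (rep W) hWO
    have htoGr := toGr_normalize R (rep W) hWO hmem
    rw [toGr_rep] at htoGr
    have hC : toGr ⟨_, hmem⟩ ∈ C := by rwa [htoGr]
    -- f is evaluated on the normalized representative, which stays over C because it represents the
    -- same point.
    have h2 := hfg ⟨⟨_, hmem⟩, hC⟩ trivial hWS.1
    rw [he₁ ⟨_, hmem⟩ hWS.1 hWS.2] at h2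
    refine Eq.trans ?_ h2
    congr 1
    exact Subtype.ext htoGr.symm

/-- Ranks of configurations of linear images are lower semicontinuous. -/
theorem isOpen_le_finrank_iSup_map {E : Type*} [Finite E]
    (L : Fin r → (Fin k → K) →ₗ[K] (E → K)) (n : ℕ) :
    IsOpen[(variety K α k).zariski]
      {W | n ≤ Module.finrank K ↥(⨆ t, (W t).1.map (L t))} := by
  classical
  have := Fintype.ofFinite E
  let Q := fullRankSpace K α k
  let _ := Q.zariski
  let M : fullRankBlocks K α k → Matrix E (Cols α) K := fun A =>
    Matrix.of fun e c => L c.1 (fun i => A.1 i c) e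
  have hM : Q.IsRegularMatrix Set.univ M := fun e c => by
    have : ∀ A, M A e c = ∑ i, LinearMap.toMatrix' (L c.1) e i * A.1 i c := fun A => by
      change L c.1 _ e = _
      rw [← LinearMap.toMatrix'_mulVec]
      rfl
    simp only [this]
    exact regular_sum _ fun i _ => Q.mul (Q.const _ _) (isRegularMatrix_induced _ _ i c)
  have hspan : ∀ A, (⨆ t, ((toGr A : Gr K α k) t).1.map (L t)) =
      LinearMap.range (M A).mulVecLin := fun A => by
    rw [Matrix.range_mulVecLin]
    simp only [toGr, blockSpan, Submodule.map_span, ← Submodule.span_iUnion]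
    congr 1
    ext v
    simp only [Set.mem_iUnion, Set.mem_image, Set.mem_range]
    constructor
    · rintro ⟨t, _, ⟨c, rfl⟩, rfl⟩
      exact ⟨⟨t, c⟩, rfl⟩
    · rintro ⟨⟨t, c⟩, rfl⟩
      exact ⟨t, _, ⟨c, rfl⟩, rfl⟩
  rw [isOpen_variety_iff]
  refine isOpen_iff_forall_mem_open.2 fun A₀ hA₀ => ?_
  rw [Set.mem_preimage, Set.mem_ofPred_eq, hspan] at hA₀
  -- A substitute for a nonvanishing minor: H expresses n independent vectors of the column space
  -- through the columns of M A₀, and G is a left inverse of the matrix of these vectors. With G and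
  -- H fixed, det (G M A H) ≠ 0 is an open condition that forces rank at least n.
  obtain ⟨G, H, hGH⟩ : ∃ (G : Matrix (Fin n) E K) (H : Matrix (Cols α) (Fin n) K),
      G * M A₀ * H = 1 := by
    let b := Module.finBasis K (LinearMap.range (M A₀).mulVecLin)
    choose h hh using fun c : Fin n => (b (Fin.castLE hA₀ c)).2
    have hli : LinearIndependent K fun c => (b (Fin.castLE hA₀ c) : E → K) :=
      (b.linearIndependent.comp _ (Fin.castLE_injective hA₀)).map' (Submodule.subtype _)
        (Submodule.ker_subtype _)
    have hcol : (M A₀ * Matrix.of fun i c => h c i).col =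
        fun c => (b (Fin.castLE hA₀ c) : E → K) := by
      funext c
      rw [← hh]
      rfl
    rw [← hcol, ← Matrix.mulVec_injective_iff] at hli
    obtain ⟨G, hG⟩ := exists_leftInverse_matrix fun x hx =>
      hli (hx.trans (Matrix.mulVec_zero _).symm)
    exact ⟨G, _, by rw [Matrix.mul_assoc, hG]⟩
  refine ⟨{A | A ∈ Set.univ ∧ (G * M A * H).det ≠ 0}, ?_, Q.isOpen_ne_zero isOpen_univ
    (IsRegularMatrix.det (((IsRegularMatrix.const _).mul hM).mul (IsRegularMatrix.const _))),
    trivial, by simp [hGH]⟩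
  rintro A ⟨-, hA⟩
  rw [Set.mem_preimage, Set.mem_ofPred_eq, hspan]
  have h1 := Matrix.rank_of_det_ne_zero hA
  calc n = (G * M A * H).rank := by simp [h1]
    _ ≤ (G * M A).rank := Matrix.rank_mul_le_left _ _
    _ ≤ (M A).rank := Matrix.rank_mul_le_right _ _
    _ = _ := rfl

end GrassmannProduct

namespace GrassmannProduct

variable {K : Type*} [Field K] {k : ℕ}

/-! ### Pivots of a subspace -/

open Classical in
/-- The positions of the leading entries of the vectors in a subspace. -/
noncomputable def pivots (V : Submodule K (Fin k → K)) : Finset (Fin k) :=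
  Finset.univ.filter fun i => ∃ v ∈ V, v i ≠ 0 ∧ ∀ j < i, v j = 0

theorem mem_pivots {V : Submodule K (Fin k → K)} {i : Fin k} :
    i ∈ pivots V ↔ ∃ v ∈ V, v i ≠ 0 ∧ ∀ j < i, v j = 0 := by
  simp [pivots]

theorem pivots_mono {V W : Submodule K (Fin k → K)} (h : V ≤ W) : pivots V ⊆ pivots W :=
  fun i hi => by
    obtain ⟨v, hv, hvi⟩ := mem_pivots.1 hi
    exact mem_pivots.2 ⟨v, h hv, hvi⟩

theorem exists_leading {v : Fin k → K} (hv : v ≠ 0) : ∃ i, v i ≠ 0 ∧ ∀ j < i, v j = 0 := by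
  obtain ⟨i, hi⟩ := Function.ne_iff.1 hv
  have hwf : WellFounded ((· < ·) : Fin k → Fin k → Prop) := wellFounded_lt
  refine ⟨hwf.min {i | v i ≠ 0} ⟨i, hi⟩, hwf.min_mem {i | v i ≠ 0} ⟨i, hi⟩, fun j hj => ?_⟩
  by_contra h
  exact hwf.not_lt_min {i | v i ≠ 0} h hj

/-- The leading position of a nonzero vector of V would be a pivot. This is the source of all
uniqueness statements below: a vector of V is determined by its entries at the pivots. -/
theorem eq_zero_of_forall_pivots {V : Submodule K (Fin k → K)} {v : Fin k → K} (hv : v ∈ V)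
    (h : ∀ i ∈ pivots V, v i = 0) : v = 0 := by
  by_contra h0
  obtain ⟨i, hi, hj⟩ := exists_leading h0
  exact hi (h i (mem_pivots.2 ⟨v, hv, hi, hj⟩))

theorem linearIndependent_of_leading {s : Finset (Fin k)} (v : s → Fin k → K)
    (h1 : ∀ i, v i i ≠ 0) (h0 : ∀ (i : s), ∀ j < i.1, v i j = 0) : LinearIndependent K v := by
  classical
  rw [Fintype.linearIndependent_iff]
  intro g hg
  by_contra! h
  obtain ⟨i, hi⟩ := h
  -- The coefficients extended by zero, so that `exists_leading` yields the smallest index with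
  -- nonzero coefficient. In that coordinate only one term of the relation survives.
  let w : Fin k → K := fun j => if hj : j ∈ s then g ⟨j, hj⟩ else 0
  have hw : w ≠ 0 := fun h => hi (by simpa [w] using congrFun h i.1)
  obtain ⟨j, hj, hlt⟩ := exists_leading hw
  have hjs : j ∈ s := by
    by_contra hjs
    simp [w, hjs] at hj
  have hgj : g ⟨j, hjs⟩ ≠ 0 := by simpa [w, hjs] using hj
  have := congrFun hg j
  rw [Finset.sum_apply, Finset.sum_eq_single ⟨j, hjs⟩] at this
  · exact mul_ne_zero hgj (h1 ⟨j, hjs⟩) this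
  · rintro ⟨l, hl⟩ - hlj
    rcases lt_or_ge j l with h | h
    · simp [h0 ⟨l, hl⟩ j h]
    · have hlj' : l < j := lt_of_le_of_ne h fun h => hlj (Subtype.ext h)
      have : g ⟨l, hl⟩ = 0 := by simpa [w, hl] using hlt l hlj'
      simp [this]
  · simp

/-- The restriction of the vectors in `V` to the pivots of `V`. -/
noncomputable def restrictPivots (V : Submodule K (Fin k → K)) : V →ₗ[K] (pivots V → K) :=
  (LinearMap.funLeft K K (Subtype.val : pivots V → Fin k)).comp V.subtype

theorem restrictPivots_injective (V : Submodule K (Fin k → K)) :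
    Function.Injective (restrictPivots V) := by
  rw [← LinearMap.ker_eq_bot, LinearMap.ker_eq_bot']
  rintro ⟨v, hv⟩ h
  exact Subtype.ext (eq_zero_of_forall_pivots hv fun i hi => congrFun h ⟨i, hi⟩)

/-- Vectors with distinct leading positions are independent, and restriction to the pivots is
injective. -/
theorem card_pivots (V : Submodule K (Fin k → K)) : (pivots V).card = Module.finrank K V := by
  refine le_antisymm ?_ ?_
  · choose v hv h1 h0 using fun i : pivots V => mem_pivots.1 i.2
    have hli : LinearIndependent K fun i => (⟨v i, hv i⟩ : V) :=
      LinearIndependent.of_comp V.subtype (linearIndependent_of_leading v h1 h0)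
    simpa using hli.fintype_card_le_finrank
  · simpa using LinearMap.finrank_le_finrank_of_injective (restrictPivots_injective V)

theorem exists_mem_eq_on_pivots (V : Submodule K (Fin k → K)) (x : Fin k → K) :
    ∃ v ∈ V, ∀ i ∈ pivots V, v i = x i := by
  have : Function.Surjective (restrictPivots V) :=
    (LinearMap.injective_iff_surjective_of_finrank_eq_finrank (by simp [card_pivots])).1
      (restrictPivots_injective V)
  obtain ⟨v, hv⟩ := this fun i => x i
  exact ⟨v, v.2, fun i hi => congrFun hv ⟨i, hi⟩⟩

/-- A member of the reduced echelon basis. The entries at the pivots can be prescribed, and the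
leading position of the resulting vector is a pivot with nonzero entry, hence j. -/
theorem exists_dual_vector {V : Submodule K (Fin k → K)} {j : Fin k} (hj : j ∈ pivots V) :
    ∃ v ∈ V, v j = 1 ∧ (∀ i ∈ pivots V, i ≠ j → v i = 0) ∧ ∀ i < j, v i = 0 := by
  obtain ⟨v, hv, h⟩ := exists_mem_eq_on_pivots V (Pi.single j 1)
  have h1 : v j = 1 := by simp [h j hj]
  have h0 : ∀ i ∈ pivots V, i ≠ j → v i = 0 := fun i hi hij => by simp [h i hi, hij]
  refine ⟨v, hv, h1, h0, ?_⟩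
  obtain ⟨l, hl, hlt⟩ := exists_leading (v := v) fun h => by simp [h] at h1
  by_cases hlj : l = j
  · exact hlj ▸ hlt
  · exact absurd (h0 l (mem_pivots.2 ⟨v, hv, hl, hlt⟩) hlj) hl

/-- The vectors whose first `j` entries vanish. -/
def tail (K : Type*) [Field K] (k j : ℕ) : Submodule K (Fin k → K) where
  carrier := {v | ∀ i : Fin k, i.1 < j → v i = 0}
  zero_mem' := fun _ _ => rfl
  add_mem' := fun ha hb i hi => by simp [ha i hi, hb i hi]
  smul_mem' := fun c _ ha i hi => by simp [ha i hi]

theorem mem_tail {j : ℕ} {v : Fin k → K} : v ∈ tail K k j ↔ ∀ i : Fin k, i.1 < j → v i = 0 :=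
  Iff.rfl

/-- The pivots of V ∩ `tail` are the pivots of V from position j on. -/
theorem finrank_inf_tail (V : Submodule K (Fin k → K)) (j : ℕ) :
    Module.finrank K ↥(V ⊓ tail K k j) = ((pivots V).filter fun i => j ≤ i.1).card := by
  rw [← card_pivots]
  congr 1
  ext i
  simp only [mem_pivots, Finset.mem_filter, Submodule.mem_inf]
  constructor
  · rintro ⟨v, ⟨hv, hvt⟩, hi, hlt⟩
    exact ⟨⟨v, hv, hi, hlt⟩, not_lt.1 fun h => hi (hvt i h)⟩
  · rintro ⟨⟨v, hv, hi, hlt⟩, hji⟩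
    exact ⟨v, ⟨hv, fun l hl => hlt l (Fin.lt_def.2 (hl.trans_le hji))⟩, hi, hlt⟩

theorem finrank_map_of_injective {E F : Type*} [AddCommGroup E] [Module K E]
    [AddCommGroup F] [Module K F] {f : E →ₗ[K] F} (hf : Function.Injective f)
    (V : Submodule K E) : Module.finrank K (V.map f) = Module.finrank K V :=
  (Submodule.equivMapOfInjective f hf V).finrank_eq.symm

theorem finrank_map_add_finrank_inf_ker {E F : Type*} [AddCommGroup E] [Module K E]
    [FiniteDimensional K E] [AddCommGroup F] [Module K F] (V : Submodule K E) (f : E →ₗ[K] F) :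
    Module.finrank K (V.map f) + Module.finrank K ↥(V ⊓ LinearMap.ker f) =
      Module.finrank K V := by
  have h := LinearMap.finrank_range_add_finrank_ker (f.domRestrict V)
  rw [LinearMap.range_domRestrict, LinearMap.ker_domRestrict] at h
  rw [← h, ← finrank_map_of_injective V.injective_subtype ((LinearMap.ker f).comap V.subtype),
    Submodule.map_comap_subtype]

/-- The projection to the first `j` coordinates. -/
def truncate (K : Type*) [Field K] (k j : ℕ) : (Fin k → K) →ₗ[K] (Fin k → K) where
  toFun v i := if i.1 < j then v i else 0
  map_add' v w := by
    ext i
    by_cases h : i.1 < j <;> simp [h]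
  map_smul' c v := by
    ext i
    by_cases h : i.1 < j <;> simp [h]

theorem truncate_apply (j : ℕ) (v : Fin k → K) (i : Fin k) :
    truncate K k j v i = if i.1 < j then v i else 0 := rfl

theorem ker_truncate (j : ℕ) : LinearMap.ker (truncate K k j) = tail K k j := by
  ext v
  simp only [LinearMap.mem_ker, funext_iff, truncate_apply, mem_tail, Pi.zero_apply,
    ite_eq_right_iff]

theorem finrank_map_truncate (V : Submodule K (Fin k → K)) (j : ℕ) :
    Module.finrank K (V.map (truncate K k j)) + ((pivots V).filter fun i => j ≤ i.1).card =
      (pivots V).card := by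
  rw [← finrank_inf_tail, ← ker_truncate, finrank_map_add_finrank_inf_ker, card_pivots]

/-- A vector together with its first `j` entries. -/
def withTruncation (K : Type*) [Field K] (k j : ℕ) : (Fin k → K) →ₗ[K] (Fin k ⊕ Fin k → K) where
  toFun v := Sum.elim v (truncate K k j v)
  map_add' v w := by
    ext (i | i) <;> simp
  map_smul' c v := by
    ext (i | i) <;> simp

/-- A vector together with zeros. -/
def withZero (K : Type*) [Field K] (k : ℕ) : (Fin k → K) →ₗ[K] (Fin k ⊕ Fin k → K) where
  toFun v := Sum.elim v 0
  map_add' v w := by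
    ext (i | i) <;> simp
  map_smul' c v := by
    ext (i | i) <;> simp

/-- A vector (v, truncation of v) equals some (w, 0) exactly when v = w and the first j entries of v
vanish, so the two images meet in a copy of W ∩ V ∩ `tail`. Thus the pivots of an intersection can
be read off from ranks of sums, which are lower semicontinuous. -/
theorem finrank_map_withTruncation_sup (V W : Submodule K (Fin k → K)) (j : ℕ) :
    Module.finrank K ↥(V.map (withTruncation K k j) ⊔ W.map (withZero K k)) +
      ((pivots (W ⊓ V)).filter fun i => j ≤ i.1).card = (pivots V).card + (pivots W).card := by
  have hinj : Function.Injective (withTruncation K k j) := fun v w h =>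
    funext fun i => congrFun h (Sum.inl i)
  have hinj' : Function.Injective (withZero K k) := fun v w h =>
    funext fun i => congrFun h (Sum.inl i)
  have hinf : V.map (withTruncation K k j) ⊓ W.map (withZero K k) =
      ((W ⊓ V) ⊓ tail K k j).map (withZero K k) := by
    ext x
    constructor
    · rintro ⟨⟨v, hv, rfl⟩, w, hw, hwv⟩
      obtain rfl : w = v := funext fun i => congrFun hwv (Sum.inl i)
      refine ⟨w, ⟨⟨hw, hv⟩, ?_⟩, hwv⟩
      rw [← ker_truncate]
      exact funext fun i => (congrFun hwv (Sum.inr i)).symm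
    · rintro ⟨w, ⟨⟨hw, hv⟩, ht⟩, rfl⟩
      refine ⟨⟨w, hv, ?_⟩, w, hw, rfl⟩
      rw [← ker_truncate] at ht
      exact congrArg (Sum.elim w) (LinearMap.mem_ker.1 ht)
  have h := Submodule.finrank_sup_add_finrank_inf_eq (V.map (withTruncation K k j))
    (W.map (withZero K k))
  rwa [hinf, finrank_map_of_injective hinj', finrank_map_of_injective hinj',
    finrank_map_of_injective hinj, finrank_inf_tail, ← card_pivots, ← card_pivots] at h

/-- Whether i belongs to s is the difference of the counts from i and from i + 1 on. For this the
bound j = k has to be included. -/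
theorem eq_of_card_filter_le_eq {s s' : Finset (Fin k)}
    (h : ∀ j ≤ k, (s.filter fun i => j ≤ i.1).card = (s'.filter fun i => j ≤ i.1).card) :
    s = s' := by
  have key : ∀ (s : Finset (Fin k)) (i : Fin k), (s.filter fun l => i.1 ≤ l.1).card =
      (s.filter fun l => i.1 + 1 ≤ l.1).card + if i ∈ s then 1 else 0 := by
    intro s i
    have : (s.filter fun l => i.1 ≤ l.1) =
        (s.filter fun l => i.1 + 1 ≤ l.1) ∪ s.filter fun l => l = i := by
      ext l
      simp only [Finset.mem_filter, Finset.mem_union, Fin.ext_iff, ← and_or_left]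
      exact and_congr_right fun _ => by omega
    rw [this, Finset.card_union_of_disjoint, Finset.filter_eq']
    · split_ifs <;> simp
    · rw [Finset.disjoint_filter]
      rintro l - h1 rfl
      omega
  ext i
  have h1 := h i i.2.le
  rw [key s, key s', h (i + 1) i.2] at h1
  by_cases hs : i ∈ s <;> by_cases hs' : i ∈ s' <;> simp_all

end GrassmannProduct

namespace GrassmannProduct

variable {K : Type*} [Field K] {r k : ℕ} {α : Fin r → ℕ}

/-! ### Coordinate subspaces, unitriangular matrices, partial sums -/

/-- The vectors supported on `P`. -/
def supported (K : Type*) [Field K] {k : ℕ} (P : Finset (Fin k)) : Submodule K (Fin k → K) where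
  carrier := {v | ∀ i, i ∉ P → v i = 0}
  zero_mem' := fun _ _ => rfl
  add_mem' := fun ha hb i hi => by simp [ha i hi, hb i hi]
  smul_mem' := fun c _ ha i hi => by simp [ha i hi]

theorem single_mem_supported {P : Finset (Fin k)} {i : Fin k} (hi : i ∈ P) (c : K) :
    (Pi.single i c : Fin k → K) ∈ supported K P := fun j hj => by
  have : j ≠ i := fun h => hj (h ▸ hi)
  simp [this]

theorem supported_mono {P Q : Finset (Fin k)} (h : P ⊆ Q) : supported K P ≤ supported K Q :=
  fun _ hv i hi => hv i fun h' => hi (h h')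

theorem supported_le_of_single_mem {P : Finset (Fin k)} {V : Submodule K (Fin k → K)}
    (h : ∀ i ∈ P, (Pi.single i 1 : Fin k → K) ∈ V) : supported K P ≤ V := fun v hv => by
  rw [pi_eq_sum_univ' v]
  refine Submodule.sum_mem _ fun i _ => ?_
  by_cases hi : i ∈ P
  · refine Submodule.smul_mem _ _ ?_
    convert h i hi using 1
  · rw [hv i hi, zero_smul]
    exact V.zero_mem

theorem pivots_supported (P : Finset (Fin k)) : pivots (supported K P) = P := by
  ext i
  rw [mem_pivots]
  constructor
  · rintro ⟨v, hv, hi, -⟩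
    by_contra h
    exact hi (hv i h)
  · intro hi
    exact ⟨Pi.single i 1, single_mem_supported hi 1, by simp, fun j hj => by simp [hj.ne]⟩

/-- Lower triangular matrices with ones on the diagonal. -/
def IsLowerUnitriangular (u : Matrix (Fin k) (Fin k) K) : Prop :=
  (∀ i, u i i = 1) ∧ ∀ i j, i < j → u i j = 0

namespace IsLowerUnitriangular

variable {u : Matrix (Fin k) (Fin k) K} (hu : IsLowerUnitriangular u)

include hu

theorem mulVec_apply {v : Fin k → K} {i : Fin k} (h : ∀ j < i, v j = 0) :
    (u.mulVec v) i = v i := by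
  rw [Matrix.mulVec, dotProduct, Finset.sum_eq_single i]
  · rw [hu.1, one_mul]
  · intro j _ hj
    rcases lt_or_gt_of_ne hj with h' | h'
    · rw [h j h', mul_zero]
    · rw [hu.2 i j h', zero_mul]
  · simp

theorem mulVec_leading {v : Fin k → K} {i : Fin k} (hi : v i ≠ 0) (h : ∀ j < i, v j = 0) :
    (u.mulVec v) i ≠ 0 ∧ ∀ j < i, (u.mulVec v) j = 0 :=
  ⟨by rwa [hu.mulVec_apply h], fun j hj => by
    rw [hu.mulVec_apply fun l hl => h l (hl.trans hj), h j hj]⟩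

theorem eq_zero_of_mulVec {v : Fin k → K} (h : u.mulVec v = 0) : v = 0 := by
  by_contra h0
  obtain ⟨i, hi, hj⟩ := exists_leading h0
  exact (hu.mulVec_leading hi hj).1 (congrFun h i)

theorem injective : Function.Injective u.mulVecLin :=
  (injective_iff_map_eq_zero _).2 fun _ => hu.eq_zero_of_mulVec

theorem surjective : Function.Surjective u.mulVecLin :=
  LinearMap.injective_iff_surjective.1 hu.injective

theorem det_ne_zero : u.det ≠ 0 := fun h => by
  obtain ⟨v, hv, huv⟩ := Matrix.exists_mulVec_eq_zero_iff.2 h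
  exact hv (hu.eq_zero_of_mulVec huv)

/-- A lower unitriangular matrix preserves the leading position of every nonzero vector. -/
theorem pivots_map (V : Submodule K (Fin k → K)) : pivots (V.map u.mulVecLin) = pivots V := by
  ext i
  constructor
  · intro h
    obtain ⟨_, ⟨v, hv, rfl⟩, hi, hlt⟩ := mem_pivots.1 h
    have hv0 : v ≠ 0 := by
      rintro rfl
      simp at hi
    obtain ⟨l, hl, hllt⟩ := exists_leading hv0
    obtain ⟨h1, h2⟩ := hu.mulVec_leading hl hllt
    rcases lt_trichotomy l i with h' | rfl | h'
    · exact absurd (hlt l h') h1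
    · exact mem_pivots.2 ⟨v, hv, hl, hllt⟩
    · exact absurd (h2 i h') hi
  · intro h
    obtain ⟨v, hv, hi, hlt⟩ := mem_pivots.1 h
    exact mem_pivots.2 ⟨_, ⟨v, hv, rfl⟩, hu.mulVec_leading hi hlt⟩

end IsLowerUnitriangular

/-- The sum of the members of a family of subspaces with index below `n`. -/
def partialSup (V : Fin r → Submodule K (Fin k → K)) (n : ℕ) : Submodule K (Fin k → K) :=
  ⨆ t : Fin r, ⨆ _ : t.1 < n, V t

theorem le_partialSup (V : Fin r → Submodule K (Fin k → K)) {n : ℕ} {t : Fin r} (h : t.1 < n) :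
    V t ≤ partialSup V n :=
  le_iSup₂_of_le (f := fun (t : Fin r) (_ : t.1 < n) => V t) t h le_rfl

theorem partialSup_le {V : Fin r → Submodule K (Fin k → K)} {n : ℕ}
    {T : Submodule K (Fin k → K)} (h : ∀ t : Fin r, t.1 < n → V t ≤ T) : partialSup V n ≤ T :=
  iSup₂_le h

theorem partialSup_mono (V : Fin r → Submodule K (Fin k → K)) {m n : ℕ} (h : m ≤ n) :
    partialSup V m ≤ partialSup V n :=
  partialSup_le fun _ ht => le_partialSup V (ht.trans_le h)

theorem partialSup_succ (V : Fin r → Submodule K (Fin k → K)) (t : Fin r) :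
    partialSup V (t.1 + 1) = V t ⊔ partialSup V t.1 := by
  refine le_antisymm (partialSup_le fun s hs => ?_)
    (sup_le (le_partialSup V (Nat.lt_succ_self _)) (partialSup_mono V (Nat.le_succ _)))
  rcases (Nat.lt_succ_iff_lt_or_eq.1 hs) with h | h
  · exact (le_partialSup V h).trans le_sup_right
  · rw [Fin.ext h]
    exact le_sup_left

theorem partialSup_map (V : Fin r → Submodule K (Fin k → K)) (n : ℕ)
    (f : (Fin k → K) →ₗ[K] (Fin k → K)) :
    partialSup (fun t => (V t).map f) n = (partialSup V n).map f := by
  simp only [partialSup, Submodule.map_iSup]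

theorem partialSup_eq_iSup (V : Fin r → Submodule K (Fin k → K)) :
    partialSup V r = ⨆ t, V t :=
  iSup_congr fun t => iSup_pos t.2

/-! ### Set sequences and patterns -/

namespace SetSequence

variable (I : SetSequence α k)

/-- The union of the first `n` sets. -/
def upTo (n : ℕ) : Finset (Fin k) := (Finset.univ.filter fun t : Fin r => t.1 < n).biUnion I.sets

theorem mem_upTo {n : ℕ} {i : Fin k} : i ∈ I.upTo n ↔ ∃ t : Fin r, t.1 < n ∧ i ∈ I.sets t := by
  simp [upTo]

theorem before_eq_upTo (t : Fin r) : I.before t = I.upTo t.1 := by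
  ext i
  simp [upTo, before]

theorem upTo_succ (t : Fin r) : I.upTo (t.1 + 1) = I.sets t ∪ I.before t := by
  ext i
  simp only [before_eq_upTo, Finset.mem_union, mem_upTo]
  constructor
  · rintro ⟨s, hs, hi⟩
    rcases (Nat.lt_succ_iff_lt_or_eq.1 hs) with h | h
    · exact Or.inr ⟨s, h, hi⟩
    · exact Or.inl (Fin.ext h ▸ hi)
  · rintro (h | ⟨s, hs, hi⟩)
    · exact ⟨t, Nat.lt_succ_self _, h⟩
    · exact ⟨s, hs.trans (Nat.lt_succ_self _), hi⟩

theorem upTo_mono {m n : ℕ} (h : m ≤ n) : I.upTo m ⊆ I.upTo n := fun i hi => by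
  obtain ⟨t, ht, hit⟩ := I.mem_upTo.1 hi
  exact I.mem_upTo.2 ⟨t, ht.trans_le h, hit⟩

theorem covers_iff : I.Covers ↔ I.upTo r = Finset.univ := by
  simp only [Covers, Finset.eq_univ_iff_forall, mem_upTo]
  exact forall_congr' fun i => exists_congr fun t => by simp [t.2]

theorem exists_new {n : ℕ} {i : Fin k} (hi : i ∈ I.upTo n) :
    ∃ t : Fin r, t.1 < n ∧ i ∈ I.sets t ∧ i ∉ I.before t := by
  induction n with
  | zero =>
    obtain ⟨t, ht, -⟩ := I.mem_upTo.1 hi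
    exact absurd ht (Nat.not_lt_zero _)
  | succ n ih =>
    by_cases h : i ∈ I.upTo n
    · obtain ⟨t, ht, h'⟩ := ih h
      exact ⟨t, ht.trans (Nat.lt_succ_self _), h'⟩
    · obtain ⟨t, ht, hit⟩ := I.mem_upTo.1 hi
      rcases (Nat.lt_succ_iff_lt_or_eq.1 ht) with h' | h'
      · exact absurd (I.mem_upTo.2 ⟨t, h', hit⟩) h
      · refine ⟨t, ht, hit, ?_⟩
        rwa [before_eq_upTo, h']

theorem new_unique {s t : Fin r} {i : Fin k} (hs : i ∈ I.sets s ∧ i ∉ I.before s)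
    (ht : i ∈ I.sets t ∧ i ∉ I.before t) : s = t := by
  rcases lt_trichotomy s t with h | h | h
  · exact absurd (by rw [before_eq_upTo, mem_upTo]; exact ⟨s, h, hs.1⟩) ht.2
  · exact h
  · exact absurd (by rw [before_eq_upTo, mem_upTo]; exact ⟨t, h, ht.1⟩) hs.2

theorem unipotent_isLowerUnitriangular {u : Matrix (Fin k) (Fin k) K}
    (hu : u ∈ I.unipotent K) : IsLowerUnitriangular u := ⟨hu.1, hu.2.1⟩

theorem one_mem_unipotent : (1 : Matrix (Fin k) (Fin k) K) ∈ I.unipotent K :=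
  ⟨fun i => by simp, fun i j h => by simp [h.ne], fun i j h _ => by simp [h.ne']⟩

/-- A numbering of the rows for which `π^(t)` lists the rows increasingly. -/
def rowKey (t : Fin r) (i : Fin k) : ℕ := if i ∈ I.before t then k + i.1 else i.1

theorem precedes_iff {t : Fin r} {i j : Fin k} :
    I.Precedes t i j ↔ I.rowKey t i < I.rowKey t j := by
  have hi := i.2
  have hj := j.2
  by_cases h1 : i ∈ I.before t <;> by_cases h2 : j ∈ I.before t <;>
    simp [rowKey, Precedes, h1, h2] <;> omega

theorem rowKey_injective (t : Fin r) : Function.Injective (I.rowKey t) := fun i j h => by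
  have hi := i.2
  have hj := j.2
  simp only [rowKey] at h
  split_ifs at h <;> exact Fin.ext (by omega)

/-- The elements of I_t are sorted by `rowKey`. -/
theorem exists_isPivotList (t : Fin r) : ∃ p, I.IsPivotList t p := by
  have hcard : ((I.sets t).image (I.rowKey t)).card = α t := by
    rw [Finset.card_image_of_injective _ (I.rowKey_injective t), I.card t]
  have hmem : ∀ c, ∃ i ∈ I.sets t, I.rowKey t i =
      ((I.sets t).image (I.rowKey t)).orderEmbOfFin hcard c := fun c =>
    Finset.mem_image.1 (Finset.orderEmbOfFin_mem _ hcard c)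
  choose p hp hkey using hmem
  refine ⟨p, fun i => ⟨fun hi => ?_, ?_⟩, fun c d hcd => ?_⟩
  · have : I.rowKey t i ∈ Set.range (((I.sets t).image (I.rowKey t)).orderEmbOfFin hcard) := by
      rw [Finset.range_orderEmbOfFin]
      exact Finset.mem_coe.2 (Finset.mem_image_of_mem _ hi)
    obtain ⟨c, hc⟩ := this
    exact ⟨c, I.rowKey_injective t ((hkey c).trans hc)⟩
  · rintro ⟨c, rfl⟩
    exact hp c
  · rw [precedes_iff, hkey, hkey]
    exact (Finset.orderEmbOfFin _ hcard).strictMono hcd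

theorem isPivotList_unique {t : Fin r} {p q : Fin (α t) → Fin k} (hp : I.IsPivotList t p)
    (hq : I.IsPivotList t q) : p = q := by
  have hp' : StrictMono (I.rowKey t ∘ p) := fun c d h => I.precedes_iff.1 (hp.2 c d h)
  have hq' : StrictMono (I.rowKey t ∘ q) := fun c d h => I.precedes_iff.1 (hq.2 c d h)
  have hrange : Set.range (I.rowKey t ∘ p) = Set.range (I.rowKey t ∘ q) := by
    have : Set.range p = Set.range q := by
      ext i
      exact (hp.1 i).symm.trans (hq.1 i)
    rw [Set.range_comp, Set.range_comp, this]
  exact (I.rowKey_injective t).comp_left ((hp'.range_inj hq').1 hrange)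

/-- The pivot rows of block `t`. -/
noncomputable def pivotList (t : Fin r) : Fin (α t) → Fin k := (I.exists_isPivotList t).choose

theorem isPivotList_pivotList (t : Fin r) : I.IsPivotList t (I.pivotList t) :=
  (I.exists_isPivotList t).choose_spec

theorem pivotList_mem (t : Fin r) (c : Fin (α t)) : I.pivotList t c ∈ I.sets t :=
  ((I.isPivotList_pivotList t).1 _).2 ⟨c, rfl⟩

theorem exists_pivotList_eq {t : Fin r} {i : Fin k} (hi : i ∈ I.sets t) :
    ∃ c, I.pivotList t c = i :=
  ((I.isPivotList_pivotList t).1 _).1 hi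

theorem pivotList_injective (t : Fin r) : Function.Injective (I.pivotList t) := fun c d h => by
  by_contra hne
  rcases lt_or_gt_of_ne hne with h' | h'
  · have := I.precedes_iff.1 ((I.isPivotList_pivotList t).2 _ _ h')
    rw [h] at this
    exact lt_irrefl _ this
  · have := I.precedes_iff.1 ((I.isPivotList_pivotList t).2 _ _ h')
    rw [h] at this
    exact lt_irrefl _ this

theorem fitsPattern_iff {B : Matrix (Fin k) (Cols α) K} :
    I.FitsPattern B ↔ ∀ t c j, (I.symbol t (I.pivotList t c) j).Fits (B j ⟨t, c⟩) := by
  refine forall_congr' fun t => ⟨?_, fun h => ⟨_, I.isPivotList_pivotList t, h⟩⟩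
  rintro ⟨p, hp, h⟩
  rwa [← I.isPivotList_unique hp (I.isPivotList_pivotList t)]

/-- If the pivot i is in P_t, every row outside P_t precedes it. If i is new, a row j ≠ i outside
P_t either precedes i or falls under the extra zeros of the pattern. So all stars lie in rows of
P_t. Inside P_t the order gives a condition only when i is in P_t, because for new i these rows come
after i. -/
theorem fits_symbol_iff {t : Fin r} {i : Fin k} {v : Fin k → K} :
    (∀ j, (I.symbol t i j).Fits (v j)) ↔ v i = 1 ∧ (∀ j ∈ I.sets t, j ≠ i → v j = 0) ∧
      (∀ j, j ∉ I.before t → j ≠ i → v j = 0) ∧ (i ∈ I.before t → ∀ j < i, v j = 0) := by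
  constructor
  · intro h
    have hz : ∀ j, j ≠ i → I.Precedes t j i → v j = 0 := fun j hj hp => by
      have := h j
      simp only [symbol, if_neg hj, if_pos hp, ite_self] at this
      exact this
    refine ⟨by simpa [symbol, PatternSymbol.Fits] using h i, fun j hj hji => ?_,
      fun j hj hji => ?_, fun hi j hj => hz j hj.ne ?_⟩
    · have := h j
      simp only [symbol, if_neg hji, if_pos hj] at this
      exact this
    · by_cases hi : i ∈ I.before t
      · exact hz j hji (Or.inl ⟨hj, hi⟩)
      · rcases lt_or_gt_of_ne hji with h' | h'
        · exact hz j hji (Or.inr ⟨by simp [hi, hj], h'⟩)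
        · have := h j
          simp only [symbol, if_neg hji, if_pos (show i ∉ I.before t ∧ j ∉ I.before t ∧ i < j from
            ⟨hi, hj, h'⟩), ite_self] at this
          exact this
    · by_cases hj' : j ∈ I.before t
      · exact Or.inr ⟨by simp [hi, hj'], hj⟩
      · exact Or.inl ⟨hj', hi⟩
  · rintro ⟨h1, h2, h3, h4⟩ j
    unfold symbol
    split_ifs with hji hj hp hq
    · exact hji ▸ h1
    · exact h2 j hj hji
    · rcases hp with ⟨hj', -⟩ | ⟨hiff, hlt⟩
      · exact h3 j hj' hji
      · by_cases hi : i ∈ I.before t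
        · exact h4 hi j hlt
        · exact h3 j (fun h => hi (hiff.1 h)) hji
    · exact h3 j hq.2.1 hji
    · trivial

end SetSequence

end GrassmannProduct

/-! ### Partial sums and pivots on a cell -/

namespace GrassmannProduct

variable {K : Type*} [Field K] {r k : ℕ} {α : Fin r → ℕ}

theorem blockSpan_mul (u : Matrix (Fin k) (Fin k) K) (B : Matrix (Fin k) (Cols α) K) (t : Fin r) :
    blockSpan (u * B) t = (blockSpan B t).map u.mulVecLin := by
  rw [blockSpan, blockSpan, Submodule.map_span, ← Set.range_comp]
  rfl

namespace SetSequence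

variable (I : SetSequence α k)

section Fits

variable {I} {B : Matrix (Fin k) (Cols α) K} (hB : I.FitsPattern B)

include hB

/-- The column of a matrix fitting the pattern with a given pivot. -/
theorem exists_column {t : Fin r} {i : Fin k} (hi : i ∈ I.sets t) :
    ∃ v ∈ blockSpan B t, v i = 1 ∧ (∀ j ∈ I.sets t, j ≠ i → v j = 0) ∧
      (∀ j, j ∉ I.before t → j ≠ i → v j = 0) ∧ (i ∈ I.before t → ∀ j < i, v j = 0) := by
  obtain ⟨c, rfl⟩ := I.exists_pivotList_eq hi
  exact ⟨fun j => B j ⟨t, c⟩, Submodule.subset_span ⟨c, rfl⟩,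
    I.fits_symbol_iff.1 (I.fitsPattern_iff.1 hB t c)⟩

theorem submatrix_pivotList (t : Fin r) :
    (block B t).submatrix (I.pivotList t) id = 1 := by
  ext c d
  obtain ⟨h1, h2, -⟩ := I.fits_symbol_iff.1 (I.fitsPattern_iff.1 hB t d)
  by_cases h : c = d
  · subst h
    simpa using h1
  · rw [Matrix.one_apply_ne h]
    exact h2 _ (I.pivotList_mem t c) fun h' => h (I.pivotList_injective t h')

theorem mul_mem_fullRankBlocks {u : Matrix (Fin k) (Fin k) K} (hu : u ∈ I.unipotent K) :
    u * B ∈ fullRankBlocks K α k := by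
  refine mem_fullRankBlocks_iff.2 fun t x hx => ?_
  have h1 : block (u * B) t = u * block B t := rfl
  rw [h1, ← Matrix.mulVec_mulVec] at hx
  have h2 := (I.unipotent_isLowerUnitriangular hu).eq_zero_of_mulVec hx
  have h3 := submatrix_pivotList hB t
  rw [← Matrix.one_mulVec x, ← h3]
  ext c
  exact congrFun h2 (I.pivotList t c)

theorem mem_fullRankBlocks : B ∈ fullRankBlocks K α k := by
  simpa using mul_mem_fullRankBlocks hB I.one_mem_unipotent

theorem blockSpan_le_supported (t : Fin r) : blockSpan B t ≤ supported K (I.upTo (t.1 + 1)) := by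
  refine Submodule.span_le.2 ?_
  rintro _ ⟨c, rfl⟩ j hj
  rw [upTo_succ, Finset.mem_union, not_or] at hj
  obtain ⟨-, -, h3, -⟩ := I.fits_symbol_iff.1 (I.fitsPattern_iff.1 hB t c)
  exact h3 j hj.2 fun h => hj.1 (h ▸ I.pivotList_mem t c)

/-- By induction: a column with new pivot i is e_i plus a vector supported on P_t, which already
lies in the previous sum, and the columns with pivot in P_t are supported on P_t. -/
theorem partialSup_blockSpan {n : ℕ} (hn : n ≤ r) :
    partialSup (blockSpan B) n = supported K (I.upTo n) := by
  induction n with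
  | zero =>
    refine le_antisymm (partialSup_le fun t ht => absurd ht (Nat.not_lt_zero _))
      (supported_le_of_single_mem fun i hi => ?_)
    obtain ⟨t, ht, -⟩ := I.mem_upTo.1 hi
    exact absurd ht (Nat.not_lt_zero _)
  | succ n ih =>
    have ih := ih (Nat.le_of_succ_le hn)
    let t : Fin r := ⟨n, hn⟩
    refine le_antisymm ?_ (supported_le_of_single_mem fun i hi => ?_)
    · rw [partialSup_succ _ t]
      refine sup_le (blockSpan_le_supported hB t) ?_
      change partialSup (blockSpan B) n ≤ _
      rw [ih]
      exact supported_mono (I.upTo_mono (Nat.le_succ n))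
    · by_cases hin : i ∈ I.upTo n
      · have : (Pi.single i 1 : Fin k → K) ∈ partialSup (blockSpan B) n := by
          rw [ih]
          exact single_mem_supported hin 1
        exact partialSup_mono _ (Nat.le_succ n) this
      · have hit : i ∈ I.sets t := by
          have := I.upTo_succ t ▸ hi
          rw [Finset.mem_union, before_eq_upTo] at this
          exact this.resolve_right hin
        obtain ⟨v, hv, h1, -, h3, -⟩ := exists_column hB hit
        have hs : v - Pi.single i 1 ∈ partialSup (blockSpan B) n := by
          rw [ih]
          intro j hj
          by_cases hji : j = i
          · subst hji
            simp [h1]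
          · have := h3 j (by rwa [before_eq_upTo]) hji
            simp [hji, this]
        have h5 := Submodule.sub_mem _
          (le_partialSup (blockSpan B) (Nat.lt_succ_self n : t.1 < n + 1) hv)
          (partialSup_mono _ (Nat.le_succ n) hs)
        rwa [sub_sub_cancel] at h5

/-- The columns with pivot in P_t lie in the previous sum, which is the coordinate subspace of P_t,
and lead at their pivot. By the dimension formula for sum and intersection there are no further
pivots. -/
theorem pivots_blockSpan_inf (t : Fin r) :
    pivots (blockSpan B t ⊓ partialSup (blockSpan B) t.1) = I.sets t ∩ I.before t := by
  symm
  refine Finset.eq_of_subset_of_card_le (fun i hi => ?_) ?_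
  · obtain ⟨hi, hit⟩ := Finset.mem_inter.1 hi
    obtain ⟨v, hv, h1, -, h3, h4⟩ := exists_column hB hi
    refine mem_pivots.2 ⟨v, ⟨hv, ?_⟩, by simp [h1], h4 hit⟩
    rw [partialSup_blockSpan hB t.2.le]
    intro j hj
    rw [← before_eq_upTo] at hj
    exact h3 j hj fun h => hj (h ▸ hit)
  · rw [card_pivots]
    have h := Submodule.finrank_sup_add_finrank_inf_eq (blockSpan B t)
      (partialSup (blockSpan B) t.1)
    rw [← partialSup_succ, partialSup_blockSpan hB t.2, partialSup_blockSpan hB t.2.le,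
      ← card_pivots, ← card_pivots (supported K (I.upTo t.1)), pivots_supported,
      pivots_supported, upTo_succ, finrank_blockSpan ⟨B, mem_fullRankBlocks hB⟩ t,
      ← before_eq_upTo, ← I.card t] at h
    rw [partialSup_blockSpan hB t.2.le, ← before_eq_upTo]
    have := Finset.card_union_add_card_inter (I.sets t) (I.before t)
    omega

end Fits

theorem mem_cell_iff {W : Gr K α k} : W ∈ I.cell K ↔ ∃ u ∈ I.unipotent K,
    ∃ B : Matrix (Fin k) (Cols α) K, I.FitsPattern B ∧ ∀ t, (W t).1 = blockSpan (u * B) t := by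
  constructor
  · rintro ⟨⟨A, hA⟩, ⟨u, hu, B, hB, rfl⟩, rfl⟩
    exact ⟨u, hu, B, hB, fun t => rfl⟩
  · rintro ⟨u, hu, B, hB, h⟩
    exact ⟨⟨u * B, mul_mem_fullRankBlocks hB hu⟩, ⟨u, hu, B, hB, rfl⟩,
      funext fun t => Subtype.ext (h t).symm⟩

variable {I} in
theorem partialSup_of_mem_cell {W : Gr K α k} {u : Matrix (Fin k) (Fin k) K}
    {B : Matrix (Fin k) (Cols α) K} (hB : I.FitsPattern B)
    (hW : ∀ t, (W t).1 = blockSpan (u * B) t) {n : ℕ} (hn : n ≤ r) :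
    partialSup (fun t => (W t).1) n = (supported K (I.upTo n)).map u.mulVecLin := by
  simp only [hW, blockSpan_mul]
  rw [partialSup_map, partialSup_blockSpan hB hn]

variable {I} in
theorem pivots_partialSup {W : Gr K α k} (hW : W ∈ I.cell K) {n : ℕ} (hn : n ≤ r) :
    pivots (partialSup (fun t => (W t).1) n) = I.upTo n := by
  obtain ⟨u, hu, B, hB, h⟩ := I.mem_cell_iff.1 hW
  rw [partialSup_of_mem_cell hB h hn, (I.unipotent_isLowerUnitriangular hu).pivots_map,
    pivots_supported]

variable {I} in
theorem pivots_inf_partialSup {W : Gr K α k} (hW : W ∈ I.cell K) (t : Fin r) :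
    pivots ((W t).1 ⊓ partialSup (fun t => (W t).1) t.1) = I.sets t ∩ I.before t := by
  obtain ⟨u, hu, B, hB, h⟩ := I.mem_cell_iff.1 hW
  have hu' := I.unipotent_isLowerUnitriangular hu
  rw [partialSup_of_mem_cell hB h t.2.le, h, blockSpan_mul, ← Submodule.map_inf _ hu'.injective,
    hu'.pivots_map, ← partialSup_blockSpan hB t.2.le, pivots_blockSpan_inf hB]

variable {I} in
theorem mem_spanning_iff {W : Gr K α k} (hW : W ∈ I.cell K) :
    W ∈ spanning K α k ↔ I.Covers := by
  rw [covers_iff, ← pivots_partialSup hW le_rfl, partialSup_eq_iSup]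
  change (⨆ t, (W t).1) = ⊤ ↔ _
  rw [← Finset.card_eq_iff_eq_univ, card_pivots, Fintype.card_fin]
  constructor
  · intro h
    rw [h, finrank_top, Module.finrank_fin_fun]
  · intro h
    exact Submodule.eq_top_of_finrank_eq (by rw [h, Module.finrank_fin_fun])

/-- The point with u = 1 and all stars zero. -/
theorem cell_nonempty : (I.cell K).Nonempty := by
  let B : Matrix (Fin k) (Cols α) K := Matrix.of fun j c =>
    if j = I.pivotList c.1 c.2 then 1 else 0
  have hB : I.FitsPattern B := I.fitsPattern_iff.2 fun t c => I.fits_symbol_iff.2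
    ⟨by simp [B], fun j _ hj => by simp [B, hj], fun j _ hj => by simp [B, hj],
      fun _ j hj => by simp [B, hj.ne]⟩
  exact ⟨toGr ⟨1 * B, mul_mem_fullRankBlocks hB I.one_mem_unipotent⟩,
    I.mem_cell_iff.2 ⟨1, I.one_mem_unipotent, B, hB, fun t => rfl⟩⟩

/-- I_t is the union of I_t ∩ P_t and of what the union of the sets gains at step t. -/
theorem ext_of_upTo_of_inter {I J : SetSequence α k} (h : ∀ n ≤ r, I.upTo n = J.upTo n)
    (h' : ∀ t, I.sets t ∩ I.before t = J.sets t ∩ J.before t) : I = J := by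
  have key : ∀ (I : SetSequence α k) (t : Fin r),
      I.sets t = (I.sets t ∩ I.before t) ∪ (I.upTo (t.1 + 1) \ I.upTo t.1) := fun I t => by
    ext i
    simp only [upTo_succ, before_eq_upTo, Finset.mem_union, Finset.mem_inter, Finset.mem_sdiff]
    tauto
  have hs : I.sets = J.sets := funext fun t => by
    rw [key I, key J, h' t, h _ t.2, h _ t.2.le]
  cases I
  cases J
  congr

instance : Finite (SetSequence α k) :=
  Finite.of_injective (fun I : SetSequence α k => I.sets) fun I J h => by
    cases I
    cases J
    congr

end SetSequence

end GrassmannProduct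

/-! ### Every configuration lies in a cell -/

namespace GrassmannProduct

variable {K : Type*} [Field K] {r k : ℕ} {α : Fin r → ℕ}

/-- The set sequence of the cell through a point of the Grassmann product. -/
noncomputable def setSequence (hα : ∀ t, 1 ≤ α t) (W : Gr K α k) : SetSequence α k :=
  have hcard : ∀ t : Fin r, (pivots ((W t).1 ⊓ partialSup (fun t => (W t).1) t.1) ∪
      (pivots (partialSup (fun t => (W t).1) (t.1 + 1)) \
        pivots (partialSup (fun t => (W t).1) t.1))).card = α t := fun t => by
    rw [Finset.card_union_of_disjoint, Finset.card_sdiff_of_subset (pivots_mono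
      (partialSup_mono _ (Nat.le_succ _))), card_pivots, card_pivots, card_pivots,
      partialSup_succ]
    -- The cardinality is dim (W_t ∩ S_t) + dim (W_t + S_t) − dim S_t = dim W_t.
    · have h := Submodule.finrank_sup_add_finrank_inf_eq (W t).1
        (partialSup (fun t => (W t).1) t.1)
      have h' := Submodule.finrank_mono
        (le_sup_right : partialSup (fun t => (W t).1) t.1 ≤ (W t).1 ⊔ _)
      have h'' := (W t).2
      omega
    · rw [Finset.disjoint_left]
      intro i hi hi'
      exact (Finset.mem_sdiff.1 hi').2 (pivots_mono inf_le_right hi)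
  { sets := fun t => pivots ((W t).1 ⊓ partialSup (fun t => (W t).1) t.1) ∪
      (pivots (partialSup (fun t => (W t).1) (t.1 + 1)) \
        pivots (partialSup (fun t => (W t).1) t.1))
    nonempty := fun t => Finset.card_pos.1 (by rw [hcard]; exact hα t)
    card := hcard }

variable (hα : ∀ t, 1 ≤ α t) (W : Gr K α k)

theorem setSequence_upTo {n : ℕ} (hn : n ≤ r) :
    (setSequence hα W).upTo n = pivots (partialSup (fun t => (W t).1) n) := by
  induction n with
  | zero =>
    have h : partialSup (fun t => (W t).1) 0 = ⊥ :=
      le_bot_iff.1 (partialSup_le fun t ht => absurd ht (Nat.not_lt_zero _))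
    have h' : (pivots (partialSup (fun t => (W t).1) 0)).card = 0 := by
      rw [card_pivots, h, finrank_bot]
    rw [Finset.card_eq_zero.1 h']
    refine Finset.eq_empty_of_forall_notMem fun i hi => ?_
    obtain ⟨t, ht, -⟩ := (SetSequence.mem_upTo _).1 hi
    exact absurd ht (Nat.not_lt_zero _)
  | succ n ih =>
    have ih := ih (Nat.le_of_succ_le hn)
    have h := (setSequence hα W).upTo_succ ⟨n, hn⟩
    rw [SetSequence.before_eq_upTo] at h
    refine h.trans ?_
    change (pivots _ ∪ (_ \ _)) ∪ (setSequence hα W).upTo n = _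
    rw [ih]
    ext i
    have h1 : i ∈ pivots ((W ⟨n, hn⟩).1 ⊓ partialSup (fun t => (W t).1) n) →
      i ∈ pivots (partialSup (fun t => (W t).1) n) := fun hi => pivots_mono inf_le_right hi
    have h2 : i ∈ pivots (partialSup (fun t => (W t).1) n) →
      i ∈ pivots (partialSup (fun t => (W t).1) (n + 1)) := fun hi =>
        pivots_mono (partialSup_mono _ (Nat.le_succ _)) hi
    simp only [Finset.mem_union, Finset.mem_sdiff]
    tauto

theorem setSequence_before (t : Fin r) :
    (setSequence hα W).before t = pivots (partialSup (fun t => (W t).1) t.1) := by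
  rw [SetSequence.before_eq_upTo, setSequence_upTo hα W t.2.le]

theorem setSequence_inter_before (t : Fin r) :
    (setSequence hα W).sets t ∩ (setSequence hα W).before t =
      pivots ((W t).1 ⊓ partialSup (fun t => (W t).1) t.1) := by
  rw [setSequence_before]
  change (pivots _ ∪ (_ \ _)) ∩ _ = _
  ext i
  have h1 : i ∈ pivots ((W t).1 ⊓ partialSup (fun t => (W t).1) t.1) →
    i ∈ pivots (partialSup (fun t => (W t).1) t.1) := fun hi => pivots_mono inf_le_right hi
  simp only [Finset.mem_union, Finset.mem_inter, Finset.mem_sdiff]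
  tauto

/-- If j is new in I_t, column j of u is the reduced echelon vector of S_{t+1} with pivot j. It
vanishes in the other rows of P_t ∪ I_t, and these are exactly the zeros that `unipotent` demands.
The columns indexed by `upTo n` then lie in S_n, and their number is dim S_n. -/
theorem exists_unipotent : ∃ u ∈ (setSequence hα W).unipotent K, ∀ n ≤ r,
    (supported K ((setSequence hα W).upTo n)).map u.mulVecLin =
      partialSup (fun t => (W t).1) n := by
  let I := setSequence hα W
  have hcol : ∀ j, ∃ v : Fin k → K, v j = 1 ∧ (∀ i < j, v i = 0) ∧
      (∀ i, j < i → (¬ ∃ t, (j ∈ I.sets t ∧ j ∉ I.before t) ∧ i ∉ I.before t ∧ i ∉ I.sets t) →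
        v i = 0) ∧ ∀ t, j ∈ I.sets t ∧ j ∉ I.before t →
          v ∈ partialSup (fun t => (W t).1) (t.1 + 1) := by
    intro j
    by_cases h : ∃ t, j ∈ I.sets t ∧ j ∉ I.before t
    · obtain ⟨t, ht⟩ := h
      have hup : I.upTo (t.1 + 1) = pivots (partialSup (fun t => (W t).1) (t.1 + 1)) :=
        setSequence_upTo hα W t.2
      have hj : j ∈ pivots (partialSup (fun t => (W t).1) (t.1 + 1)) := by
        rw [← hup, I.upTo_succ]
        exact Finset.mem_union_left _ ht.1
      obtain ⟨v, hv, h1, h0, hlt⟩ := exists_dual_vector hj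
      refine ⟨v, h1, hlt, fun i hi hn => h0 i ?_ hi.ne', fun s hs => ?_⟩
      · rw [← hup, I.upTo_succ, Finset.mem_union]
        by_contra hc
        rw [not_or] at hc
        exact hn ⟨t, ht, hc.2, hc.1⟩
      · rwa [I.new_unique hs ht]
    -- An index that is new in no I_t gets a column of the identity matrix.
    · exact ⟨Pi.single j 1, by simp, fun i hi => by simp [hi.ne], fun i hi _ => by simp [hi.ne'],
        fun t ht => absurd ⟨t, ht⟩ h⟩
  choose v h1 hlt h0 hmem using hcol
  let u : Matrix (Fin k) (Fin k) K := Matrix.of fun i j => v j i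
  have hu : u ∈ I.unipotent K := ⟨h1, fun i j hij => hlt j i hij, fun i j hij h => h0 j i hij h⟩
  have hu' := I.unipotent_isLowerUnitriangular hu
  refine ⟨u, hu, fun n hn => ?_⟩
  refine Submodule.eq_of_le_of_finrank_eq (Submodule.map_le_iff_le_comap.2
    (supported_le_of_single_mem fun j hj => ?_)) ?_
  · obtain ⟨t, ht, hnew⟩ := I.exists_new hj
    have : u.mulVecLin (Pi.single j 1) = v j := by
      rw [Matrix.mulVecLin_apply, Matrix.mulVec_single_one]
      rfl
    rw [Submodule.mem_comap, this]
    exact partialSup_mono _ ht (hmem j t hnew)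
  · rw [finrank_map_of_injective hu'.injective, ← card_pivots, ← card_pivots, pivots_supported,
      setSequence_upTo hα W hn]

/-- Applying u⁻¹ turns S_t into the coordinate subspace of P_t, and V = u⁻¹(W_t ∩ S_t) has pivots
I_t ∩ P_t. For i in P_t the column of B is the reduced echelon vector of V at i. For new i, write u
e_i in S_{t+1} = W_t + S_t as w + u s with s supported on P_t: then e_i − s lies in u⁻¹W_t, and an
element of V corrects its entries in the rows I_t ∩ P_t. The resulting columns of uB span W_t by
dimension. -/
theorem mem_cell_setSequence : W ∈ (setSequence hα W).cell K := by
  obtain ⟨u, hu, hS⟩ := exists_unipotent hα W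
  have hinter := setSequence_inter_before hα W
  set I := setSequence hα W
  have hu' := I.unipotent_isLowerUnitriangular hu
  have hcol : ∀ t, ∀ i ∈ I.sets t, ∃ b : Fin k → K, u.mulVec b ∈ (W t).1 ∧
      ∀ j, (I.symbol t i j).Fits (b j) := by
    intro t i hi
    let V : Submodule K (Fin k → K) :=
      ((W t).1 ⊓ partialSup (fun t => (W t).1) t.1).comap u.mulVecLin
    have hV : pivots V = I.sets t ∩ I.before t := by
      rw [hinter, ← hu'.pivots_map, Submodule.map_comap_eq_of_surjective hu'.surjective]
    have hVs : V ≤ supported K (I.before t) := by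
      rintro v ⟨-, hv⟩
      rw [← hS _ t.2.le, ← I.before_eq_upTo] at hv
      obtain ⟨v', hv', h⟩ := hv
      rwa [← hu'.injective h]
    by_cases hit : i ∈ I.before t
    · have hiV : i ∈ pivots V := by
        rw [hV]
        exact Finset.mem_inter.2 ⟨hi, hit⟩
      obtain ⟨b, hb, h1, h0, hlt⟩ := exists_dual_vector hiV
      refine ⟨b, hb.1, I.fits_symbol_iff.2 ⟨h1, fun j hj hji => ?_, fun j hj _ => hVs hb j hj,
        fun _ => hlt⟩⟩
      by_cases hjt : j ∈ I.before t
      · exact h0 j (hV ▸ Finset.mem_inter.2 ⟨hj, hjt⟩) hji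
      · exact hVs hb j hjt
    · have hmem : u.mulVecLin (Pi.single i 1) ∈ partialSup (fun t => (W t).1) (t.1 + 1) := by
        rw [← hS _ t.2]
        refine ⟨_, single_mem_supported ?_ 1, rfl⟩
        rw [I.upTo_succ]
        exact Finset.mem_union_left _ hi
      rw [partialSup_succ] at hmem
      obtain ⟨w, hw, s, hs, hws⟩ := Submodule.mem_sup.1 hmem
      rw [← hS _ t.2.le, ← I.before_eq_upTo] at hs
      obtain ⟨s, hs, rfl⟩ := hs
      -- Subtracting v clears the rows of I_t ∩ P_t without leaving u⁻¹W_t. As v is supported on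
      -- P_t, row i is not affected.
      obtain ⟨v, hv, hvs⟩ := exists_mem_eq_on_pivots V (Pi.single i 1 - s)
      have hsi : ∀ j, j ∉ I.before t → s j = 0 := hs
      refine ⟨Pi.single i 1 - s - v, ?_, I.fits_symbol_iff.2 ⟨?_, fun j hj hji => ?_,
        fun j hj hji => ?_, fun h => absurd h hit⟩⟩
      · have : u.mulVec (Pi.single i 1 - s - v) = w - u.mulVecLin v := by
          rw [← Matrix.mulVecLin_apply, map_sub, map_sub, ← hws, add_sub_cancel_right]
        rw [this]
        exact Submodule.sub_mem _ hw hv.1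
      · simp [hsi i hit, hVs hv i hit]
      · by_cases hjt : j ∈ I.before t
        · have := hvs j (hV ▸ Finset.mem_inter.2 ⟨hj, hjt⟩)
          rw [Pi.sub_apply, this, sub_self]
        · simp [hsi j hjt, hVs hv j hjt, hji]
      · simp [hsi j hj, hVs hv j hj, hji]
  choose b hb hfit using hcol
  let B : Matrix (Fin k) (Cols α) K := Matrix.of fun j c =>
    b c.1 (I.pivotList c.1 c.2) (I.pivotList_mem c.1 c.2) j
  have hB : I.FitsPattern B := I.fitsPattern_iff.2 fun t c j => hfit t _ _ j
  refine I.mem_cell_iff.2 ⟨u, hu, B, hB, fun t => ?_⟩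
  symm
  refine Submodule.eq_of_le_of_finrank_eq (Submodule.span_le.2 ?_) ?_
  · rintro _ ⟨c, rfl⟩
    exact hb t _ (I.pivotList_mem t c)
  · rw [(W t).2]
    exact finrank_blockSpan ⟨_, SetSequence.mul_mem_fullRankBlocks hB hu⟩ t

end GrassmannProduct

namespace GrassmannProduct

variable {K : Type*} [Field K] {r k : ℕ} {α : Fin r → ℕ}

/-! ### Rank conditions -/

/-- The indices of the rank conditions that cut out the cells. -/
abbrev RankIndex (r k : ℕ) : Type := (Fin (r + 1) × Fin (k + 1)) ⊕ (Fin r × Fin (k + 1))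

/-- The ranks that are constant on cells and determine them. -/
noncomputable def rankFn (W : Gr K α k) : RankIndex r k → ℕ
  | .inl (n, j) => Module.finrank K
      ((partialSup (fun t => (W t).1) n.1).map (truncate K k j))
  | .inr (t, j) => Module.finrank K
      ↥((partialSup (fun t => (W t).1) t.1).map (withTruncation K k j) ⊔
        (W t).1.map (withZero K k))

/-- Both kinds of rank are dimensions of sums of images L_t(W_t), with L_t zero on the blocks that
do not take part. -/
theorem isOpen_le_rankFn (a : RankIndex r k) (n : ℕ) :
    IsOpen[(variety K α k).zariski] {W | n ≤ rankFn W a} := by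
  rcases a with ⟨m, j⟩ | ⟨t, j⟩
  · convert isOpen_le_finrank_iSup_map (K := K) (α := α)
      (fun t : Fin r => if t.1 < m.1 then truncate K k j else 0) n using 5 with W
    have : (⨆ t : Fin r, (W t).1.map (if t.1 < m.1 then truncate K k j else 0)) =
        (partialSup (fun t => (W t).1) m.1).map (truncate K k j) := by
      simp only [partialSup, Submodule.map_iSup]
      refine iSup_congr fun t => ?_
      by_cases h : t.1 < m.1 <;> simp [h]
    rw [this]
    rfl
  · convert isOpen_le_finrank_iSup_map (K := K) (α := α)
      (fun s : Fin r => if s.1 < t.1 then withTruncation K k j else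
        if s = t then withZero K k else 0) n using 5 with W
    have : (⨆ s : Fin r, (W s).1.map (if s.1 < t.1 then withTruncation K k j else
        if s = t then withZero K k else 0)) =
        (partialSup (fun t => (W t).1) t.1).map (withTruncation K k j) ⊔
          (W t).1.map (withZero K k) := by
      refine le_antisymm (iSup_le fun s => ?_) (sup_le ?_ ?_)
      · split_ifs with h1 h2
        · exact (Submodule.map_mono (le_partialSup (fun t => (W t).1) h1)).trans le_sup_left
        · exact h2 ▸ le_sup_right
        · simp
      · rw [partialSup, Submodule.map_iSup]
        refine iSup_mono fun s => ?_
        rw [Submodule.map_iSup]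
        exact iSup_le fun h => by rw [if_pos h]
      · refine le_iSup_of_le t ?_
        rw [if_neg (lt_irrefl _), if_pos rfl]
    rw [this]
    rfl

namespace SetSequence

/-- The values of the ranks on the cell of a set sequence. -/
def rank (I : SetSequence α k) : RankIndex r k → ℕ
  | .inl (n, j) => (I.upTo n).card - ((I.upTo n).filter fun i => j.1 ≤ i.1).card
  | .inr (t, j) => (I.upTo t).card + α t -
      ((I.sets t ∩ I.before t).filter fun i => j.1 ≤ i.1).card

theorem rankFn_of_mem_cell {I : SetSequence α k} {W : Gr K α k} (hW : W ∈ I.cell K)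
    (a : RankIndex r k) : rankFn W a = I.rank a := by
  rcases a with ⟨n, j⟩ | ⟨t, j⟩
  · have h := finrank_map_truncate (partialSup (fun t => (W t).1) n.1) j.1
    rw [pivots_partialSup hW (Nat.lt_succ_iff.1 n.2)] at h
    exact Nat.eq_sub_of_add_eq h
  · have h := finrank_map_withTruncation_sup (partialSup (fun t => (W t).1) t.1) (W t).1 j.1
    rw [pivots_inf_partialSup hW, pivots_partialSup hW t.2.le, card_pivots (W t).1, (W t).2] at h
    exact Nat.eq_sub_of_add_eq h

theorem rank_last (I : SetSequence α k) :
    I.rank (.inl (Fin.last r, Fin.last k)) = (I.upTo r).card := by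
  have : ((I.upTo r).filter fun i => k ≤ i.1) = ∅ :=
    Finset.filter_eq_empty_iff.2 fun i _ => not_le.2 i.2
  simp [rank, this]

theorem rank_injective : Function.Injective (rank : SetSequence α k → RankIndex r k → ℕ) := by
  intro I J h
  -- These bounds show that the natural number subtractions in `rank` are not truncated, so they can
  -- be cancelled.
  have hle : ∀ (s : Finset (Fin k)) (j : ℕ), (s.filter fun i => j ≤ i.1).card ≤ s.card :=
    fun s j => Finset.card_filter_le _ _
  have hup : ∀ n ≤ r, I.upTo n = J.upTo n := fun n hn => by
    have h1 : ∀ j ≤ k, (I.upTo n).card - ((I.upTo n).filter fun i => j ≤ i.1).card =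
        (J.upTo n).card - ((J.upTo n).filter fun i => j ≤ i.1).card := fun j hj =>
      congrFun h (.inl (⟨n, Nat.lt_succ_of_le hn⟩, ⟨j, Nat.lt_succ_of_le hj⟩))
    have h2 : ∀ s : Finset (Fin k), (s.filter fun i => k ≤ i.1).card = 0 := fun s =>
      Finset.card_eq_zero.2 (Finset.filter_eq_empty_iff.2 fun i _ => not_le.2 i.2)
    refine eq_of_card_filter_le_eq fun j hj => ?_
    -- At j = k the filtered sets are empty, so the total cardinalities agree.
    have h3 := h1 k le_rfl
    rw [h2, h2] at h3
    have h4 := h1 j hj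
    have h5 := hle (I.upTo n) j
    have h6 := hle (J.upTo n) j
    omega
  refine ext_of_upTo_of_inter hup fun t => eq_of_card_filter_le_eq fun j hj => ?_
  have h1 : (I.upTo t).card + α t - ((I.sets t ∩ I.before t).filter fun i => j ≤ i.1).card =
      (J.upTo t).card + α t - ((J.sets t ∩ J.before t).filter fun i => j ≤ i.1).card :=
    congrFun h (.inr (t, ⟨j, Nat.lt_succ_of_le hj⟩))
  rw [hup t t.2.le] at h1
  have h2 : ∀ I : SetSequence α k,
      ((I.sets t ∩ I.before t).filter fun i => j ≤ i.1).card ≤ α t := fun I =>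
    (hle _ j).trans (I.card t ▸ Finset.card_le_card Finset.inter_subset_left)
  have h3 := h2 I
  have h4 := h2 J
  omega

theorem cell_disjoint {I J : SetSequence α k} (h : I ≠ J) : Disjoint (I.cell K) (J.cell K) :=
  Set.disjoint_left.2 fun W hI hJ => h (rank_injective (funext fun a => by
    rw [← rankFn_of_mem_cell hI, rankFn_of_mem_cell hJ]))

/-- The level of a cell in the paving. -/
def level (I : SetSequence α k) : ℕ ×ₗ ℕ := toLex ((I.upTo r).card, ∑ a, I.rank a)

/-- O requires every rank to be at least its value on the cell of I. On another cell meeting O all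
ranks are at least as large and, as they determine the cell, one is larger. The first component of
`level` is itself one of the ranks, so it cannot drop; in case of a tie the rank sum decides. -/
theorem exists_isOpen_cell_subset (I : SetSequence α k) :
    ∃ O : Set (Gr K α k), IsOpen[(variety K α k).zariski] O ∧ I.cell K ⊆ O ∧
      ∀ J : SetSequence α k, ∀ W ∈ O, W ∈ J.cell K → J = I ∨ I.level < J.level := by
  let _ := (variety K α k).zariski
  refine ⟨⋂ a, {W | I.rank a ≤ rankFn W a},
    isOpen_iInter_of_finite fun a => isOpen_le_rankFn a _,
    fun W hW => Set.mem_iInter.2 fun a => (rankFn_of_mem_cell hW a).ge, fun J W hW hJ => ?_⟩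
  have hle : ∀ a, I.rank a ≤ J.rank a := fun a =>
    (Set.mem_iInter.1 hW a).trans (rankFn_of_mem_cell hJ a).le
  by_cases h : J = I
  · exact Or.inl h
  · have hne : ∃ a, I.rank a < J.rank a := by
      by_contra! hge
      exact h (rank_injective (funext fun a => le_antisymm (hge a) (hle a)))
    obtain ⟨a, ha⟩ := hne
    have h1 : ∑ a, I.rank a < ∑ a, J.rank a :=
      Finset.sum_lt_sum (fun a _ => hle a) ⟨a, Finset.mem_univ _, ha⟩
    have h2 := hle (.inl (Fin.last r, Fin.last k))
    rw [rank_last, rank_last] at h2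
    refine Or.inr (Prod.Lex.toLex_lt_toLex.2 ?_)
    rcases h2.lt_or_eq with h3 | h3
    · exact Or.inl h3
    · exact Or.inr ⟨h3, h1⟩

theorem covers_iff_le_level (I : SetSequence α k) : I.Covers ↔ toLex (k, 0) ≤ I.level := by
  have hle : (I.upTo r).card ≤ k := by simpa using Finset.card_le_univ (I.upTo r)
  rw [covers_iff, ← Finset.card_eq_iff_eq_univ, Fintype.card_fin, level, Prod.Lex.toLex_le_toLex]
  simp only [Nat.zero_le, and_true]
  omega

end SetSequence

end GrassmannProduct

/-! ### Coordinates on a cell -/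

namespace GrassmannProduct

open SpaceWithFunctions

variable {K : Type*} [Field K] {r k : ℕ} {α : Fin r → ℕ}

theorem mem_partialSup_blockSpan {A : Matrix (Fin k) (Cols α) K} {n : ℕ} {v : Fin k → K} :
    v ∈ partialSup (blockSpan A) n ↔
      ∃ x : Cols α → K, (∀ c, ¬ c.1.1 < n → x c = 0) ∧ A.mulVec x = v := by
  classical
  constructor
  · let X : Submodule K (Cols α → K) :=
      { carrier := {x | ∀ c, ¬ c.1.1 < n → x c = 0}
        zero_mem' := fun _ _ => rfl
        add_mem' := fun ha hb i hi => by simp [ha i hi, hb i hi]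
        smul_mem' := fun c _ ha i hi => by simp [ha i hi] }
    have h : partialSup (blockSpan A) n ≤ X.map A.mulVecLin := partialSup_le fun t ht => by
      refine Submodule.span_le.2 ?_
      rintro _ ⟨c, rfl⟩
      refine ⟨Pi.single ⟨t, c⟩ 1, fun d hd => ?_, ?_⟩
      · have : d ≠ ⟨t, c⟩ := by
          rintro rfl
          exact hd ht
        simp [this]
      · rw [Matrix.mulVecLin_apply, Matrix.mulVec_single_one]
        rfl
    intro hv
    obtain ⟨x, hx, hxv⟩ := h hv
    exact ⟨x, hx, hxv⟩
  · rintro ⟨x, hx, rfl⟩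
    rw [Matrix.mulVec_eq_sum]
    refine Submodule.sum_mem _ fun c _ => ?_
    by_cases hc : c.1.1 < n
    · rw [op_smul_eq_smul]
      exact Submodule.smul_mem _ _ (le_partialSup (blockSpan A) hc
        (Submodule.subset_span ⟨c.2, rfl⟩))
    · rw [hx c hc]
      simp

theorem PatternSymbol.eq_zero_or_one_or_star (s : PatternSymbol) :
    s = .zero ∨ s = .one ∨ s = .star := by
  cases s <;> simp

theorem PatternSymbol.fits_of_eq_star {s : PatternSymbol} (h : s = .star) (y : K) : s.Fits y := by
  subst h
  trivial

namespace SetSequence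

variable {I : SetSequence α k}

/-- The columns of `u` are determined by the partial sums of the configuration. -/
theorem eq_column_of_mem_partialSup {W : Gr K α k} {u : Matrix (Fin k) (Fin k) K}
    {B : Matrix (Fin k) (Cols α) K} (hu : u ∈ I.unipotent K) (hB : I.FitsPattern B)
    (hW : ∀ t, (W t).1 = blockSpan (u * B) t) {t : Fin r} {j : Fin k}
    (hj : j ∈ I.sets t ∧ j ∉ I.before t) {v : Fin k → K}
    (hv : v ∈ partialSup (fun t => (W t).1) (t.1 + 1))
    (hvj : ∀ i ∈ I.upTo (t.1 + 1), v i = if i = j then 1 else 0) (i : Fin k) : u i j = v i := by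
  have hjt : j ∈ I.upTo (t.1 + 1) := by
    rw [upTo_succ]
    exact Finset.mem_union_left _ hj.1
  have huj : (fun i => u i j) ∈ partialSup (fun t => (W t).1) (t.1 + 1) := by
    rw [partialSup_of_mem_cell hB hW t.2]
    refine ⟨_, single_mem_supported hjt 1, ?_⟩
    rw [Matrix.mulVecLin_apply, Matrix.mulVec_single_one]
    rfl
  -- Column j of u and v both lie in the partial sum through block t and have the same entries at
  -- its pivots.
  have h0 := eq_zero_of_forall_pivots (Submodule.sub_mem _ huj hv) fun i hi => by
    rw [pivots_partialSup (I.mem_cell_iff.2 ⟨u, hu, B, hB, hW⟩) t.2] at hi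
    rw [Pi.sub_apply, hvj i hi]
    rcases lt_trichotomy i j with h | h | h
    · rw [hu.2.1 i j h, if_neg h.ne, sub_zero]
    · rw [h, hu.1, if_pos rfl, sub_self]
    · rw [if_neg h.ne', sub_zero]
      refine hu.2.2 i j h ?_
      rintro ⟨s, hs, hi1, hi2⟩
      obtain rfl := I.new_unique hs hj
      rw [upTo_succ, Finset.mem_union] at hi
      exact hi.elim hi2 hi1
  exact sub_eq_zero.1 (congrFun h0 i)

/-- The block `B_t` is determined by `u` and the configuration. -/
theorem block_eq_of_blockSpan_eq {A : Matrix (Fin k) (Cols α) K}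
    (hA : A ∈ fullRankBlocks K α k) {u : Matrix (Fin k) (Fin k) K}
    {B : Matrix (Fin k) (Cols α) K} (hu : u ∈ I.unipotent K) (hB : I.FitsPattern B) {t : Fin r}
    (h : blockSpan A t = blockSpan (u * B) t) :
    ((u⁻¹ * block A t).submatrix (I.pivotList t) id).det ≠ 0 ∧
      block B t = u⁻¹ * block A t * ((u⁻¹ * block A t).submatrix (I.pivotList t) id)⁻¹ := by
  obtain ⟨g, hg⟩ := exists_eq_mul_of_blockSpan_le h.le
  have hdet := det_ne_zero_of_block_eq_mul hA hg
  have hudet := (I.unipotent_isLowerUnitriangular hu).det_ne_zero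
  have h1 : u⁻¹ * block A t = block B t * g := by
    have : block (u * B) t = u * block B t := rfl
    rw [hg, this, Matrix.mul_assoc, ← Matrix.mul_assoc,
      Matrix.nonsing_inv_mul _ hudet.isUnit, Matrix.one_mul]
  -- The pivot rows of B_t form the identity matrix, so the same rows of u⁻¹A_t = B_t g recover g.
  have h2 : (u⁻¹ * block A t).submatrix (I.pivotList t) id = g := by
    have h3 : (block B t * g).submatrix (I.pivotList t) id =
      (block B t).submatrix (I.pivotList t) id * g := rfl
    rw [h1, h3, submatrix_pivotList hB, Matrix.one_mul]
  rw [h2, h1, Matrix.mul_assoc, Matrix.mul_nonsing_inv _ hdet.isUnit, Matrix.mul_one]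
  exact ⟨hdet, rfl⟩

variable (I)

/-- The positions below the diagonal at which a matrix in `unipotent I` is arbitrary. -/
abbrev FreeLower : Type := {ij : Fin k × Fin k // ij.2 < ij.1 ∧
  ∃ t, (ij.2 ∈ I.sets t ∧ ij.2 ∉ I.before t) ∧ ij.1 ∉ I.before t ∧ ij.1 ∉ I.sets t}

/-- The positions of the stars in the pattern matrix. -/
abbrev Star : Type := {jc : Fin k × Cols α //
  I.symbol jc.2.1 (I.pivotList jc.2.1 jc.2.2) jc.1 = .star}

open Classical in
/-- The matrix in `unipotent I` with given free entries. -/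
noncomputable def lowerOf (x : I.FreeLower ⊕ I.Star → K) : Matrix (Fin k) (Fin k) K :=
  Matrix.of fun i j => if h : j < i ∧
    ∃ t, (j ∈ I.sets t ∧ j ∉ I.before t) ∧ i ∉ I.before t ∧ i ∉ I.sets t then
      x (.inl ⟨(i, j), h⟩) else if i = j then 1 else 0

open Classical in
/-- The matrix fitting the pattern of `I` with given entries in place of the stars. -/
noncomputable def patternOf (x : I.FreeLower ⊕ I.Star → K) : Matrix (Fin k) (Cols α) K :=
  Matrix.of fun j c => if h : I.symbol c.1 (I.pivotList c.1 c.2) j = .star then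
    x (.inr ⟨(j, c), h⟩) else if I.symbol c.1 (I.pivotList c.1 c.2) j = .one then 1 else 0

theorem lowerOf_mem (x : I.FreeLower ⊕ I.Star → K) : I.lowerOf x ∈ I.unipotent K := by
  refine ⟨fun i => ?_, fun i j hij => ?_, fun i j hij h => ?_⟩
  · simp [lowerOf]
  · simp [lowerOf, hij.not_gt, hij.ne]
  · have h' : ¬ (j < i ∧
        ∃ t, (j ∈ I.sets t ∧ j ∉ I.before t) ∧ i ∉ I.before t ∧ i ∉ I.sets t) := fun h' => h h'.2
    rw [lowerOf, Matrix.of_apply, dif_neg h', if_neg hij.ne']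

theorem fitsPattern_patternOf (x : I.FreeLower ⊕ I.Star → K) : I.FitsPattern (I.patternOf x) := by
  refine I.fitsPattern_iff.2 fun t c j => ?_
  rw [patternOf, Matrix.of_apply]
  rcases (I.symbol t (I.pivotList t c) j).eq_zero_or_one_or_star with h | h | h
  · simp [PatternSymbol.Fits, h]
  · simp [PatternSymbol.Fits, h]
  · exact PatternSymbol.fits_of_eq_star h _

theorem exists_lowerOf_patternOf_eq {u : Matrix (Fin k) (Fin k) K}
    {B : Matrix (Fin k) (Cols α) K} (hu : u ∈ I.unipotent K) (hB : I.FitsPattern B) :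
    ∃ x, I.lowerOf x = u ∧ I.patternOf x = B := by
  refine ⟨Sum.elim (fun ij => u ij.1.1 ij.1.2) (fun jc => B jc.1.1 jc.1.2), ?_, ?_⟩
  · ext i j
    rw [lowerOf, Matrix.of_apply]
    split_ifs with h h'
    · rfl
    · rw [h', hu.1]
    · rcases lt_or_gt_of_ne h' with h'' | h''
      · exact (hu.2.1 i j h'').symm
      · exact (hu.2.2 i j h'' fun hex => h ⟨h'', hex⟩).symm
  · ext j ⟨t, c⟩
    have hfit := I.fitsPattern_iff.1 hB t c j
    rw [patternOf, Matrix.of_apply]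
    rcases (I.symbol t (I.pivotList t c) j).eq_zero_or_one_or_star with h | h | h
    · simp only [h, PatternSymbol.Fits] at hfit
      simp [h, hfit]
    · simp only [h, PatternSymbol.Fits] at hfit
      simp [h, hfit]
    · rw [dif_pos h]
      rfl

theorem eq_of_lowerOf_eq_of_patternOf_eq {x y : I.FreeLower ⊕ I.Star → K}
    (h : I.lowerOf x = I.lowerOf y) (h' : I.patternOf x = I.patternOf y) : x = y := by
  funext s
  rcases s with ⟨⟨i, j⟩, hs⟩ | ⟨⟨j, c⟩, hs⟩
  · have := congrFun (congrFun h i) j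
    rwa [lowerOf, lowerOf, Matrix.of_apply, Matrix.of_apply, dif_pos hs, dif_pos hs] at this
  · have := congrFun (congrFun h' j) c
    rwa [patternOf, patternOf, Matrix.of_apply, Matrix.of_apply, dif_pos hs, dif_pos hs] at this

/-- The parametrization of the cell of `I`. -/
noncomputable def param (x : I.FreeLower ⊕ I.Star → K) : I.cell K :=
  ⟨toGr ⟨I.lowerOf x * I.patternOf x,
    mul_mem_fullRankBlocks (I.fitsPattern_patternOf x) (I.lowerOf_mem x)⟩,
    I.mem_cell_iff.2 ⟨_, I.lowerOf_mem x, _, I.fitsPattern_patternOf x, fun _ => rfl⟩⟩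

theorem lowerOf_eq_of_notMem {j : Fin k} (hj : ∀ t, ¬ (j ∈ I.sets t ∧ j ∉ I.before t))
    (x : I.FreeLower ⊕ I.Star → K) (i : Fin k) :
    I.lowerOf x i j = (1 : Matrix (Fin k) (Fin k) K) i j := by
  rw [lowerOf, Matrix.of_apply, dif_neg fun h => hj _ h.2.choose_spec.1, Matrix.one_apply]

/-- Each nontrivial column of u is the unique vector of a partial sum with prescribed entries at the
pivots, so it depends on the configuration only. Given u, each block of B is determined by a
representing matrix. -/
theorem param_injective : Function.Injective (I.param (K := K)) := by
  intro x y h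
  have hW : ∀ t, ((I.param x).1 t).1 = blockSpan (I.lowerOf y * I.patternOf y) t := fun t => by
    rw [h]
    rfl
  have hW' : ∀ t, ((I.param x).1 t).1 = blockSpan (I.lowerOf x * I.patternOf x) t := fun t => rfl
  have hu : I.lowerOf x = I.lowerOf y := by
    ext i j
    by_cases hj : ∃ t, j ∈ I.sets t ∧ j ∉ I.before t
    · obtain ⟨t, ht⟩ := hj
      obtain ⟨v, hv, hvj⟩ := exists_mem_eq_on_pivots
        (partialSup (fun t => ((I.param x).1 t).1) (t.1 + 1)) (Pi.single j 1)
      rw [pivots_partialSup (I.param x).2 t.2] at hvj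
      simp only [Pi.single_apply] at hvj
      rw [eq_column_of_mem_partialSup (I.lowerOf_mem x) (I.fitsPattern_patternOf x) hW' ht hv hvj,
        eq_column_of_mem_partialSup (I.lowerOf_mem y) (I.fitsPattern_patternOf y) hW ht hv hvj]
    · rw [not_exists] at hj
      rw [I.lowerOf_eq_of_notMem hj, I.lowerOf_eq_of_notMem hj]
  refine I.eq_of_lowerOf_eq_of_patternOf_eq hu (block_ext fun t => ?_)
  have hA := mul_mem_fullRankBlocks (I.fitsPattern_patternOf x) (I.lowerOf_mem x)
  rw [(block_eq_of_blockSpan_eq hA (I.lowerOf_mem x) (I.fitsPattern_patternOf x) rfl).2,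
    (block_eq_of_blockSpan_eq hA (I.lowerOf_mem y) (I.fitsPattern_patternOf y) (hW t)).2, hu]

theorem param_surjective : Function.Surjective (I.param (K := K)) := by
  rintro ⟨W, hW⟩
  obtain ⟨u, hu, B, hB, h⟩ := I.mem_cell_iff.1 hW
  obtain ⟨x, rfl, rfl⟩ := I.exists_lowerOf_patternOf_eq hu hB
  exact ⟨x, Subtype.ext (funext fun t => Subtype.ext (h t).symm)⟩

/-- The coordinates on the cell of `I`. -/
noncomputable def paramEquiv (K : Type*) [Field K] : (I.FreeLower ⊕ I.Star → K) ≃ I.cell K :=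
  Equiv.ofBijective I.param ⟨I.param_injective, I.param_surjective⟩

theorem isMorphism_param : (affineSpace K (I.FreeLower ⊕ I.Star)).IsMorphism
    ((variety K α k).induced (I.cell K)) I.param := by
  refine IsMorphism.codRestrict ?_
  refine (isMorphism_coinduced (fullRankSpace K α k) toGr).comp (IsMorphism.codRestrict ?_)
  refine isMorphism_matrixSpace (IsRegularMatrix.mul (fun i j => ?_) fun j c => ?_)
  · simp only [lowerOf, Matrix.of_apply]
    split_ifs
    exacts [regular_coord _ _, SpaceWithFunctions.const _ _ 1, SpaceWithFunctions.const _ _ 0]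
  · simp only [patternOf, Matrix.of_apply]
    split_ifs
    exacts [regular_coord _ _, SpaceWithFunctions.const _ _ 1, SpaceWithFunctions.const _ _ 0]

/-- The coordinates of the point of the cell represented by a matrix. -/
noncomputable def coords (A : (toGr ⁻¹' I.cell K : Set (fullRankBlocks K α k))) :
    I.FreeLower ⊕ I.Star → K :=
  (I.paramEquiv K).symm ⟨toGr A.1, A.2⟩

theorem toGr_coords (A : (toGr ⁻¹' I.cell K : Set (fullRankBlocks K α k))) (t : Fin r) :
    (toGr A.1 t).1 = blockSpan (I.lowerOf (I.coords A) * I.patternOf (I.coords A)) t := by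
  have h : (I.param (I.coords A)).1 = toGr A.1 :=
    congrArg Subtype.val ((I.paramEquiv K).apply_symm_apply ⟨toGr A.1, A.2⟩)
  rw [← h]
  rfl

theorem isRegularMatrix_val :
    ((fullRankSpace K α k).induced (toGr ⁻¹' I.cell K)).IsRegularMatrix Set.univ
      (fun A => A.1.1) := fun i c =>
  (isMorphism_val (fullRankSpace K α k) (toGr ⁻¹' I.cell K)).2 Set.univ (fun A => A.1 i c)
    (@isOpen_univ _ (fullRankSpace K α k).zariski) (isRegularMatrix_induced _ _ i c)

/-- Near A₀, a column of u comes from a Cramer type formula. A constant matrix Q combines columns of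
the blocks up to t so that the rows `upTo (t + 1)` of A₀Q form the identity. Where these rows D(A)
of AQ stay invertible, the columns of A Q D(A)⁻¹ lie in the partial sum and have identity entries at
the pivots, so one of them is the column sought. -/
theorem isRegularMatrix_lowerOf :
    ((fullRankSpace K α k).induced (toGr ⁻¹' I.cell K)).IsRegularMatrix Set.univ
      (fun A => I.lowerOf (I.coords A)) := by
  intro i j
  set R := (fullRankSpace K α k).induced (toGr ⁻¹' I.cell K)
  by_cases hj : ∃ t, j ∈ I.sets t ∧ j ∉ I.before t
  swap
  · rw [not_exists] at hj
    simp only [I.lowerOf_eq_of_notMem hj]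
    exact R.const _ _
  obtain ⟨t, ht⟩ := hj
  have hjt : j ∈ I.upTo (t.1 + 1) := by
    rw [upTo_succ]
    exact Finset.mem_union_left _ ht.1
  refine R.glue fun A₀ _ => ?_
  have hcols : ∀ p : I.upTo (t.1 + 1), ∃ x : Cols α → K, (∀ c, ¬ c.1.1 < t.1 + 1 → x c = 0) ∧
      ∀ i ∈ I.upTo (t.1 + 1), (A₀.1.1.mulVec x) i = (Pi.single p.1 1 : Fin k → K) i := fun p => by
    obtain ⟨v, hv, hvp⟩ := exists_mem_eq_on_pivots
      (partialSup (blockSpan A₀.1.1) (t.1 + 1)) (Pi.single p.1 1)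
    obtain ⟨x, hx, rfl⟩ := mem_partialSup_blockSpan.1 hv
    have hpiv : pivots (partialSup (blockSpan A₀.1.1) (t.1 + 1)) = I.upTo (t.1 + 1) :=
      pivots_partialSup A₀.2 t.2
    rw [hpiv] at hvp
    exact ⟨x, hx, hvp⟩
  choose q hq hqA using hcols
  let Q : Matrix (Cols α) (I.upTo (t.1 + 1)) K := Matrix.of fun c p => q p c
  let D : (toGr ⁻¹' I.cell K : Set (fullRankBlocks K α k)) →
      Matrix (I.upTo (t.1 + 1)) (I.upTo (t.1 + 1)) K :=
    fun A => (A.1.1 * Q).submatrix Subtype.val id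
  have hAQ : R.IsRegularMatrix Set.univ fun A => A.1.1 * Q :=
    I.isRegularMatrix_val.mul (IsRegularMatrix.const _)
  have hD : R.IsRegularMatrix Set.univ D := hAQ.submatrix _ _
  have hD₀ : D A₀ = 1 := by
    ext p p'
    refine (hqA p' p.1 p.2).trans ?_
    simp only [Pi.single_apply, Matrix.one_apply, Subtype.ext_iff]
  refine ⟨{A | A ∈ Set.univ ∧ (D A).det ≠ 0},
    R.isOpen_ne_zero (@isOpen_univ _ R.zariski) hD.det, ⟨trivial, by simp [hD₀]⟩, ?_⟩
  have hreg : R.IsRegularMatrix {A | A ∈ Set.univ ∧ (D A).det ≠ 0}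
      fun A => A.1.1 * Q * (D A)⁻¹ :=
    (hAQ.mono (Set.subset_univ _)).mul
      (IsRegularMatrix.inv (hD.mono (Set.subset_univ _)) fun A hA => hA.2)
  refine R.congr (fun A hA => ?_) (R.mono Set.inter_subset_right (hreg i ⟨j, hjt⟩))
  have hdet : (D A).det ≠ 0 := hA.2.2
  symm
  refine eq_column_of_mem_partialSup (I.lowerOf_mem _) (I.fitsPattern_patternOf _)
    (I.toGr_coords A) ht (v := fun i => (A.1.1 * Q * (D A)⁻¹) i ⟨j, hjt⟩) ?_ (fun i hi => ?_) i
  · refine mem_partialSup_blockSpan.2 ⟨fun c => (Q * (D A)⁻¹) c ⟨j, hjt⟩, fun c hc => ?_, ?_⟩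
    · change (Q * (D A)⁻¹) c ⟨j, hjt⟩ = 0
      rw [Matrix.mul_apply]
      exact Finset.sum_eq_zero fun p _ => mul_eq_zero_of_left (hq p c hc) _
    · rw [Matrix.mul_assoc]
      rfl
  · have h1 : (D A * (D A)⁻¹) ⟨i, hi⟩ ⟨j, hjt⟩ = (A.1.1 * Q * (D A)⁻¹) i ⟨j, hjt⟩ := rfl
    rw [← h1, Matrix.mul_nonsing_inv _ hdet.isUnit, Matrix.one_apply]
    simp only [Subtype.mk.injEq]

/-- The formula of `block_eq_of_blockSpan_eq` writes B_t through u and A_t by products and inverses,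
and u is already known to be regular. -/
theorem isRegularMatrix_patternOf :
    ((fullRankSpace K α k).induced (toGr ⁻¹' I.cell K)).IsRegularMatrix Set.univ
      (fun A => I.patternOf (I.coords A)) := by
  rintro j ⟨t, c⟩
  set R := (fullRankSpace K α k).induced (toGr ⁻¹' I.cell K)
  have hN : R.IsRegularMatrix Set.univ fun A =>
      (I.lowerOf (I.coords A))⁻¹ * block A.1.1 t :=
    IsRegularMatrix.mul (IsRegularMatrix.inv I.isRegularMatrix_lowerOf fun A _ =>
      (I.unipotent_isLowerUnitriangular (I.lowerOf_mem _)).det_ne_zero)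
      (I.isRegularMatrix_val.submatrix _ _)
  have key := fun A : (toGr ⁻¹' I.cell K : Set (fullRankBlocks K α k)) =>
    block_eq_of_blockSpan_eq A.1.2 (I.lowerOf_mem (I.coords A))
      (I.fitsPattern_patternOf (I.coords A)) (I.toGr_coords A t)
  have hreg := hN.mul (IsRegularMatrix.inv (hN.submatrix (I.pivotList t) id) fun A _ => (key A).1)
  exact R.congr (fun A _ => (congrFun (congrFun (key A).2 j) c).symm) (hreg j c)

theorem isMorphism_paramEquiv_symm : ((variety K α k).induced (I.cell K)).IsMorphism
    (affineSpace K (I.FreeLower ⊕ I.Star)) (I.paramEquiv K).symm := by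
  refine isMorphism_affineSpace fun s => regular_of_regular_pullback ?_
  change IsRegular _ Set.univ fun A => I.coords A s
  rcases s with ⟨⟨i, j⟩, hs⟩ | ⟨⟨j, c⟩, hs⟩
  · refine SpaceWithFunctions.congr _ (fun A _ => ?_) (I.isRegularMatrix_lowerOf i j)
    simp only [lowerOf, Matrix.of_apply, dif_pos hs]
  · refine SpaceWithFunctions.congr _ (fun A _ => ?_) (I.isRegularMatrix_patternOf j c)
    simp only [patternOf, Matrix.of_apply, dif_pos hs]

theorem cell_isomorphic_affineSpace (K : Type*) [Field K] : ∃ N : ℕ,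
    (affineSpace K (Fin N)).Isomorphic ((variety K α k).induced (I.cell K)) := by
  obtain ⟨N, ⟨e⟩⟩ := Finite.exists_equiv_fin (I.FreeLower ⊕ I.Star)
  exact ⟨N, (affineSpace_isomorphic e).trans
    ⟨I.paramEquiv K, I.isMorphism_param, I.isMorphism_paramEquiv_symm⟩⟩

end SetSequence

end GrassmannProduct

theorem mainTheorem3 {K : Type*} [Field K] [IsAlgClosed K] {r k : ℕ} (α : Fin r → ℕ)
    (hα : ∀ t, 1 ≤ α t ∧ α t ≤ k) :
    (∃ (m : ℕ) (F : Fin (m + 1) → Set (GrassmannProduct.Gr K α k)),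
      (GrassmannProduct.variety K α k).IsAffinePaving
        (fun I : GrassmannProduct.SetSequence α k => I.cell K) F ∧
      ∃ i, GrassmannProduct.spanning K α k = (F i)ᶜ) ∧
    ∀ I : GrassmannProduct.SetSequence α k,
      (I.cell K ⊆ GrassmannProduct.spanning K α k ↔ I.Covers) ∧
      (¬ I.Covers → Disjoint (I.cell K) (GrassmannProduct.spanning K α k)) := by
  have hcov : ∀ W : GrassmannProduct.Gr K α k, ∃ I : GrassmannProduct.SetSequence α k,
      W ∈ I.cell K := fun W =>
    ⟨_, GrassmannProduct.mem_cell_setSequence (fun t => (hα t).1) W⟩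
  refine ⟨?_, fun I => ⟨⟨fun h => ?_, fun h W hW => ?_⟩, fun h => ?_⟩⟩
  · obtain ⟨m, F, hF, hup⟩ := SpaceWithFunctions.exists_isAffinePaving
      (GrassmannProduct.variety K α k) (fun I : GrassmannProduct.SetSequence α k => I.cell K)
      GrassmannProduct.SetSequence.level (fun I => I.cell_nonempty)
      (fun _ _ h => GrassmannProduct.SetSequence.cell_disjoint h) hcov
      (fun I => I.cell_isomorphic_affineSpace K) (fun I => I.exists_isOpen_cell_subset)
    -- The covering cells are those of level at least (k, 0), because the first component of a level
    -- never exceeds k.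
    obtain ⟨i, hi⟩ := hup (toLex (k, 0))
    refine ⟨m, F, hF, i, hi ▸ ?_⟩
    ext W
    obtain ⟨I, hI⟩ := hcov W
    constructor
    · intro hW
      exact ⟨I, hI, I.covers_iff_le_level.1
        ((GrassmannProduct.SetSequence.mem_spanning_iff hI).1 hW)⟩
    · rintro ⟨J, hJ, hle⟩
      exact (GrassmannProduct.SetSequence.mem_spanning_iff hJ).2 (J.covers_iff_le_level.2 hle)
  · obtain ⟨W, hW⟩ := I.cell_nonempty (K := K)
    exact (GrassmannProduct.SetSequence.mem_spanning_iff hW).1 (h hW)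
  · exact (GrassmannProduct.SetSequence.mem_spanning_iff hW).2 h
  · exact Set.disjoint_left.2 fun W hW hs =>
      h ((GrassmannProduct.SetSequence.mem_spanning_iff hW).1 hs)
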